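/- Let $(W,S)$ be a Coxeter system of finite rank with $m(s,s')=3$ for all $s\neq s'$ in $S$ (a 3-complete Coxeter system), with identity $e$, length function $\ell$, set of reflections $T=\{wsw^{-1}: w\in W,\ s\in S\}$, and positive roots $\Phi^+$, which correspond bijectively to $T$. A reflection ordering is a total ordering $\prec$ of $\Phi^+$ (hence of $T$) such that $\alpha\prec c_1\alpha+c_2\beta\prec\beta$ whenever $\alpha,\beta,c_1\alpha+c_2\beta\in\Phi^+$, $c_1,c_2\in\mathbb R_{>0}$ and $\alpha\prec\beta$. The Bruhat graph is the directed graph on $W$ with an edge $x\to tx$ whenever $t\in T$ and $\ell(x)<\ell(tx)$. For a directed path $\Delta=(x_0,x_1,\dots,x_{n+1})$ in it let $t_i=x_{i-1}^{-1}x_i\in T$, and let $m_\prec(\Delta)\in\mathbb Z\langle a,b\rangle$ be the product of $n$ factors, the $i$-th one being $a$ if $t_i\prec t_{i+1}$ and $b$ otherwise. For $u,v\in W$, $u<v$ in Bruhat order, the complete $cd$-index is $$\tilde\Psi_{u,v}=\sum_{\Delta}m_\prec(\Delta)\in\mathbb Z\langle a,b\rangle,$$ the sum over all directed paths $\Delta$,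 of any length, from $u$ to $v$ in the Bruhat graph, where $\prec$ is any reflection ordering. Let $r,s\in S$, $r\neq s$, and let $P$ be the parabolic subgroup of $W$ generated by $S\setminus\{r,s\}$. Then for all $v\in P$, $v\neq e$, $$\tilde\Psi_{e,svs}+d\cdot\tilde\Psi_{e,v}=\tilde\Psi_{e,rvs}+\tilde\Psi_{e,v},\qquad d=ab+ba,$$ where each of the four complete $cd$-indices may be computed with any reflection ordering. -/

import Mathlib

noncomputable section

namespace CoxeterMatrix

variable {B : Type*} (M : CoxeterMatrix B)

/-- A Coxeter matrix is 3-complete if `m(s, s') = 3` for all `s ≠ s'`. -/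
def IsThreeComplete : Prop := ∀ i j : B, i ≠ j → M i j = 3

/-- The simple root `α_i`, a basis vector of the root space `⨁_i ℝ α_i`. -/
def simpleRoot (i : B) : B →₀ ℝ := Finsupp.single i 1

/-- The linear form `2 (α_i | ·)` on the root space, where `(α_i | α_j) = - cos (π / m(i, j))`.
Mathlib encodes `m(i, j) = ∞` as `0`; then `π / 0 = 0` and `(α_i | α_j) = -1`, as usual. -/
def simpleCoroot (i : B) : (B →₀ ℝ) →ₗ[ℝ] ℝ :=
  Finsupp.linearCombination ℝ fun j => -2 * Real.cos (Real.pi / M i j)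

theorem simpleCoroot_simpleRoot (i j : B) :
    M.simpleCoroot i (simpleRoot j) = -2 * Real.cos (Real.pi / M i j) := by
  simp [simpleCoroot, simpleRoot]

theorem simpleCoroot_self (i : B) : M.simpleCoroot i (simpleRoot i) = 2 := by
  simp [simpleCoroot_simpleRoot]

/-- The simple reflection `x ↦ x - 2 (α_i | x) α_i` of the root space. -/
def rootReflection (i : B) : (B →₀ ℝ) ≃ₗ[ℝ] (B →₀ ℝ) :=
  Module.reflection (M.simpleCoroot_self i)

/-- The simple reflections of the root space satisfy the Coxeter relations. -/
theorem isLiftable_rootReflection : M.IsLiftable M.rootReflection := by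
  intro i j
  rcases eq_or_ne i j with rfl | hij
  · ext1 x
    simp [rootReflection, Module.involutive_reflection (M.simpleCoroot_self i) x]
  rcases Nat.eq_zero_or_pos (M i j) with h0 | hpos
  · rw [h0, pow_zero]
  have h1 : M i j ≠ 1 := M.off_diagonal i j hij
  have hf : M.simpleCoroot i (simpleRoot j) = -2 * Real.cos (Real.pi / M i j) :=
    M.simpleCoroot_simpleRoot i j
  have hg : M.simpleCoroot j (simpleRoot i) = -2 * Real.cos (Real.pi / M i j) := by
    rw [M.simpleCoroot_simpleRoot j i, M.symmetric j i]
  generalize M i j = m at hpos h1 hf hg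
  ext1 z
  rw [rootReflection, rootReflection,
    Module.reflection_mul_reflection_pow_apply (M.simpleCoroot_self i) (M.simpleCoroot_self j) m z
      (2 * Real.cos (2 * (Real.pi / m))) (by rw [hf, hg, Real.cos_two_mul]; ring)]
  rcases eq_or_ne m 2 with rfl | h2
  · have hc : Real.cos (Real.pi / (2 : ℕ)) = 0 := by
      rw [Nat.cast_ofNat, Real.cos_pi_div_two]
    rw [hc, mul_zero] at hf hg
    have ht : 2 * Real.cos (2 * (Real.pi / (2 : ℕ))) = -2 := by
      rw [Real.cos_two_mul, hc]; norm_num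
    rw [ht, hf, hg]
    norm_num
    module
  have hm : 3 ≤ m := by lia
  have hm0 : (m : ℝ) ≠ 0 := by positivity
  set φ : ℝ := 2 * (Real.pi / m) with hφ
  have hsin : Real.sin φ ≠ 0 := by
    apply ne_of_gt
    apply Real.sin_pos_of_pos_of_lt_pi
    · have := Real.pi_pos
      positivity
    · have h3 : (3 : ℝ) ≤ m := by exact_mod_cast hm
      rw [hφ, ← mul_div_assoc, div_lt_iff₀ (by positivity)]
      nlinarith [Real.pi_pos]
  have hS (n : ℤ) := Polynomial.Chebyshev.S_two_mul_real_cos φ n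
  obtain ⟨k, hk | hk⟩ := m.even_or_odd'
  · have hz : (Polynomial.Chebyshev.S ℝ (k - 1)).eval (2 * Real.cos φ) = 0 := by
      have h := hS (k - 1)
      have hkφ : (((k - 1 : ℤ) : ℝ) + 1) * φ = Real.pi := by
        rw [hφ]
        have : (m : ℝ) = 2 * k := by exact_mod_cast hk
        push_cast
        field_simp
        linarith
      rw [hkφ, Real.sin_pi] at h
      exact (mul_eq_zero.mp h).resolve_right hsin
    have e1 : ((m : ℤ) - 2) / 2 = k - 1 := by lia
    have e2 : ((m : ℤ) - 1) / 2 = k - 1 := by lia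
    rw [e1, e2, hz]
    simp
  · have hz : (Polynomial.Chebyshev.S ℝ k).eval (2 * Real.cos φ)
        + (Polynomial.Chebyshev.S ℝ (k - 1)).eval (2 * Real.cos φ) = 0 := by
      have h := hS k
      have h' := hS (k - 1)
      have hkφ : (((k : ℤ) : ℝ) + 1) * φ = 2 * Real.pi - (((k - 1 : ℤ) : ℝ) + 1) * φ := by
        rw [hφ]
        have : (m : ℝ) = 2 * k + 1 := by exact_mod_cast hk
        push_cast
        field_simp
        linarith
      rw [hkφ, Real.sin_two_pi_sub] at h
      refine (mul_eq_zero.mp ?_).resolve_right hsin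
      rw [add_mul, h, h', neg_add_cancel]
    have e1 : ((m : ℤ) - 2) / 2 = k - 1 := by lia
    have e2 : ((m : ℤ) - 1) / 2 = k := by lia
    have e3 : ((m : ℤ) - 3) / 2 = k - 1 := by lia
    have e4 : (m : ℤ) / 2 = k := by lia
    rw [e1, e2, e3, e4, hz]
    simp

/-- The bilinear form `2 (x | y)` on the root space. -/
def rootForm : (B →₀ ℝ) →ₗ[ℝ] (B →₀ ℝ) →ₗ[ℝ] ℝ := Finsupp.linearCombination ℝ M.simpleCoroot

theorem rootForm_symm (x y) : M.rootForm x y = M.rootForm y x := by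
  have : M.rootForm = M.rootForm.flip := by
    ext i j
    simp [rootForm, simpleCoroot, M.symmetric i j]
  conv_lhs => rw [this]
  rfl

theorem rootForm_reflection (i) (x y) :
    M.rootForm (M.rootReflection i x) (M.rootReflection i y) = M.rootForm x y := by
  have h (z) : M.rootForm (simpleRoot i) z = M.simpleCoroot i z := by simp [rootForm, simpleRoot]
  have h' (z) : M.rootForm z (simpleRoot i) = M.simpleCoroot i z := by rw [rootForm_symm, h]
  simp only [rootReflection, Module.reflection_apply, map_sub, map_smul,
    LinearMap.sub_apply, LinearMap.smul_apply, h, h', smul_eq_mul, M.simpleCoroot_self]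
  ring

end CoxeterMatrix

namespace CoxeterSystem

variable {B W : Type*} [Group W] {M : CoxeterMatrix B} (cs : CoxeterSystem M W)

/-- The geometric representation of `W` on the root space. -/
def geomRep : W →* ((B →₀ ℝ) ≃ₗ[ℝ] (B →₀ ℝ)) :=
  cs.lift ⟨M.rootReflection, M.isLiftable_rootReflection⟩

/-- `β` is a root belonging to the reflection `t`: `β = w(α_i)` and `t = w s_i w⁻¹` for some `w`
and some simple reflection `s_i`. -/
def IsRootOf (t : W) (β : B →₀ ℝ) : Prop :=
  ∃ (w : W) (i : B), t = w * cs.simple i * w⁻¹ ∧ β = cs.geomRep w (CoxeterMatrix.simpleRoot i)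

/-- The set `Φ⁺` of positive roots: the vectors of the form `w(α_i)`, with `w ∈ W`, that have only
nonnegative coordinates in the basis of simple roots. -/
def posRoots : Set (B →₀ ℝ) :=
  {β | (∃ (w : W) (i : B), β = cs.geomRep w (CoxeterMatrix.simpleRoot i)) ∧ ∀ j, 0 ≤ β j}

/-- A reflection ordering: a strict total ordering `≺` of `Φ⁺` such that `α ≺ γ ≺ β` whenever
`α ≺ β` and `γ = c₁ α + c₂ β` is a positive root, with `c₁, c₂ > 0`. -/
structure ReflectionOrdering where
  lt : cs.posRoots → cs.posRoots → Prop
  isStrictTotalOrder : IsStrictTotalOrder cs.posRoots lt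
  between : ∀ (α β γ : cs.posRoots) (c₁ c₂ : ℝ), 0 < c₁ → 0 < c₂ →
    (γ : B →₀ ℝ) = c₁ • (α : B →₀ ℝ) + c₂ • (β : B →₀ ℝ) → lt α β → lt α γ ∧ lt γ β

theorem rootForm_geomRep (w : W) :
    ∀ (x y), M.rootForm (cs.geomRep w x) (cs.geomRep w y) = M.rootForm x y := by
  induction w using cs.simple_induction_left with
  | one => intro x y; rw [map_one]; rfl
  | mul_simple_left w i ih => ?_
  intro x y
  have : cs.geomRep (cs.simple i) = M.rootReflection i := cs.lift_apply_simple _ i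
  rw [map_mul, this, LinearEquiv.mul_apply, LinearEquiv.mul_apply, M.rootForm_reflection, ih]

theorem rootForm_posRoot (β : cs.posRoots) : M.rootForm β.1 β.1 = 2 := by
  obtain ⟨β, ⟨w, i, rfl⟩, -⟩ := β
  show M.rootForm (cs.geomRep w _) (cs.geomRep w _) = 2
  rw [rootForm_geomRep]
  simpa [CoxeterMatrix.rootForm, CoxeterMatrix.simpleRoot] using M.simpleCoroot_self i

/-- The height of a vector: the sum of its coordinates. -/
def height : (B →₀ ℝ) →ₗ[ℝ] ℝ := Finsupp.linearCombination ℝ fun _ => 1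

theorem height_pos (β : cs.posRoots) : 0 < height β.1 := by
  have h0 : β.1 ≠ 0 := by intro h; have h2 := cs.rootForm_posRoot β; rw [h] at h2; simp at h2
  rw [height, Finsupp.linearCombination_apply, Finsupp.sum]
  refine Finset.sum_pos (fun i hi => ?_) (Finsupp.support_nonempty_iff.2 h0)
  have := β.2.2 i
  have h2 := Finsupp.mem_support_iff.1 hi
  simpa using lt_of_le_of_ne this h2.symm

/-- A positive root divided by its height. -/
def normalizedRoot (β : cs.posRoots) : B →₀ ℝ := (height β.1)⁻¹ • β.1

theorem normalizedRoot_injective : Function.Injective cs.normalizedRoot := by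
  intro α β h
  have ha := cs.height_pos α; have hb := cs.height_pos β
  have h1 : α.1 = (height α.1 / height β.1) • β.1 := by
    rw [div_eq_mul_inv, mul_smul, ← normalizedRoot, ← h, normalizedRoot,
      smul_smul, mul_inv_cancel₀ ha.ne', one_smul]
  set c := height α.1 / height β.1
  have hc : 0 < c := div_pos ha hb
  have h2 := cs.rootForm_posRoot α
  rw [h1] at h2
  simp [rootForm_posRoot] at h2
  have : c = 1 := by nlinarith
  rw [this, one_smul] at h1
  exact Subtype.ext h1

/-- Every Coxeter system has a reflection ordering: compare `β / height β` lexicographically. -/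
theorem nonempty_reflectionOrdering : Nonempty cs.ReflectionOrdering := by
  classical
  let _ : LinearOrder B := WellOrderingRel.isWellOrder.linearOrder
  let f : cs.posRoots → Lex (B →₀ ℝ) := fun β => toLex (cs.normalizedRoot β)
  have hf : Function.Injective f := fun α β h => cs.normalizedRoot_injective (toLex.injective h)
  refine ⟨⟨fun α β => f α < f β, ?_, ?_⟩⟩
  · exact
      { trichotomous := fun a b h1 h2 => hf (le_antisymm (not_lt.1 h2) (not_lt.1 h1))
        irrefl := fun a => lt_irrefl (f a)
        trans := fun a b c => lt_trans }
  · intro α β γ c₁ c₂ h1 h2 hγ hlt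
    have ha := cs.height_pos α; have hb := cs.height_pos β; have hg := cs.height_pos γ
    have hh : height γ.1 = c₁ * height α.1 + c₂ * height β.1 := by rw [hγ]; simp
    have key (j) : cs.normalizedRoot γ j =
        (c₁ * height α.1 / height γ.1) * cs.normalizedRoot α j
          + (c₂ * height β.1 / height γ.1) * cs.normalizedRoot β j := by
      simp only [normalizedRoot, Finsupp.smul_apply, smul_eq_mul]
      have : γ.1 j = c₁ * α.1 j + c₂ * β.1 j := by rw [hγ]; simp
      rw [this]; field_simp
    set p := c₁ * height α.1 / height γ.1
    set q := c₂ * height β.1 / height γ.1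
    have hp : 0 < p := by positivity
    have hq : 0 < q := by positivity
    have hpq : p + q = 1 := by rw [← add_div, ← hh, div_self hg.ne']
    obtain ⟨j, hj, hlt⟩ := Finsupp.Lex.lt_iff.1 hlt
    have hj' : ∀ i < j, cs.normalizedRoot α i = cs.normalizedRoot β i := hj
    have hlt' : cs.normalizedRoot α j < cs.normalizedRoot β j := hlt
    refine ⟨Finsupp.Lex.lt_iff.2 ⟨j, fun i hi => ?_, ?_⟩,
      Finsupp.Lex.lt_iff.2 ⟨j, fun i hi => ?_, ?_⟩⟩
    · show cs.normalizedRoot α i = cs.normalizedRoot γ i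
      rw [key, ← hj' i hi, ← add_mul, hpq, one_mul]
    · show cs.normalizedRoot α j < cs.normalizedRoot γ j
      have hp' : p = 1 - q := by linarith
      rw [key, hp']; nlinarith
    · show cs.normalizedRoot γ i = cs.normalizedRoot β i
      rw [key, hj' i hi, ← add_mul, hpq, one_mul]
    · show cs.normalizedRoot γ j < cs.normalizedRoot β j
      have hq' : q = 1 - p := by linarith
      rw [key, hq']; nlinarith

variable {cs} in
/-- The ordering `≺` transferred to reflections along the bijection between reflections and
positive roots. -/
def ReflectionOrdering.reflLT (o : cs.ReflectionOrdering) (t t' : W) : Prop :=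
  ∃ β β' : cs.posRoots, cs.IsRootOf t β ∧ cs.IsRootOf t' β' ∧ o.lt β β'

/-- There is a directed edge `x ⟶ y` in the Bruhat graph if `y = t x` for some reflection `t` and
`ℓ(x) < ℓ(y)`. -/
def BruhatEdge (x y : W) : Prop :=
  ∃ t : W, cs.IsReflection t ∧ y = t * x ∧ cs.length x < cs.length y

/-- `B(u, v)`: the directed paths `(x₀, x₁, …, xₙ)` in the Bruhat graph with `x₀ = u` and
`xₙ = v`, of arbitrary length `n`, as lists of vertices. -/
def bruhatPaths (u v : W) : Set (List W) :=
  {p | p.IsChain cs.BruhatEdge ∧ p.head? = some u ∧ p.getLast? = some v}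

theorem finite_setOf_length_le [Finite B] (n : ℕ) : {x : W | cs.length x ≤ n}.Finite := by
  refine ((List.finite_length_le B n).image cs.wordProd).subset fun x hx => ?_
  obtain ⟨ω, hω, rfl⟩ := cs.exists_isReduced x
  exact ⟨ω, (hω.eq.symm.le.trans hx : ω.length ≤ n), rfl⟩

theorem bruhatPaths_finite [Finite B] (u v : W) : (cs.bruhatPaths u v).Finite := by
  induction hn : cs.length v using Nat.strong_induction_on generalizing v with
  | _ n ih =>
    subst hn
    have hfin : (⋃ x ∈ {x : W | cs.length x < cs.length v},
        (fun p => p ++ [v]) '' cs.bruhatPaths u x).Finite := by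
      refine Set.Finite.biUnion ?_ fun x hx => (ih _ hx x rfl).image _
      exact (cs.finite_setOf_length_le (cs.length v)).subset fun x hx =>
        by simp only [Set.mem_ofPred_eq] at hx ⊢; exact hx.le
    refine (hfin.union (Set.finite_singleton [v])).subset ?_
    rintro p ⟨hc, hh, hl⟩
    rcases List.eq_nil_or_concat' p with rfl | ⟨q, y, rfl⟩
    · simp at hl
    obtain rfl : y = v := by simpa using hl
    rcases List.eq_nil_or_concat' q with rfl | ⟨q', x, rfl⟩
    · right; simp
    left
    rw [List.isChain_append] at hc
    obtain ⟨t, -, -, hlt⟩ := hc.2.2 x (by simp) y (by simp)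
    refine Set.mem_biUnion (show x ∈ {x : W | cs.length x < cs.length y} from hlt) ?_
    refine ⟨q' ++ [x], ⟨hc.1, ?_, by simp⟩, rfl⟩
    rwa [List.head?_append_of_ne_nil _ (by simp)] at hh

/-- The parabolic subgroup generated by the simple reflections `s_i`, `i ∈ J`. -/
def parabolic (J : Set B) : Subgroup W := Subgroup.closure (cs.simple '' J)

end CoxeterSystem

namespace CompleteCD

/-- The ring `ℤ⟨a, b⟩` of noncommutative polynomials in two variables. -/
abbrev ABPoly : Type := FreeAlgebra ℤ (Fin 2)

/-- The variable `a`. -/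
def a : ABPoly := FreeAlgebra.ι ℤ 0

/-- The variable `b`. -/
def b : ABPoly := FreeAlgebra.ι ℤ 1

/-- `d = ab + ba`. -/
def d : ABPoly := a * b + b * a

variable {B W : Type*} [Group W] {M : CoxeterMatrix B} {cs : CoxeterSystem M W}

open scoped Classical in
/-- The monomial `m_≺(Δ)` of a path `Δ = (x₀, x₁, …, x_{n+1})` with labels `t_i = x_{i-1}⁻¹ x_i`:
the product of `n` factors, the `i`-th one being `a` if `t_i ≺ t_{i+1}` and `b` otherwise. -/
def pathMonomial (o : cs.ReflectionOrdering) : List W → ABPoly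
  | x :: y :: z :: p =>
      (if o.reflLT (x⁻¹ * y) (y⁻¹ * z) then a else b) * pathMonomial o (y :: z :: p)
  | _ => 1

/-- The complete `cd`-index `Ψ̃_{u,v}`, as an element of `ℤ⟨a, b⟩`, computed with the reflection
ordering `≺`: the sum of `m_≺(Δ)` over all paths `Δ` in the Bruhat graph from `u` to `v`. -/
def completeCDIndex [Finite B] (o : cs.ReflectionOrdering) (u v : W) : ABPoly :=
  ∑ p ∈ (cs.bruhatPaths_finite u v).toFinset, pathMonomial o p

end CompleteCD

end

/-! Dyer's polynomial R̃_{u,v}(q) (`rPoly`) counts the Bruhat paths from u to v with increasing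
labels by their number of edges. In a path monomial each letter is b, plus a - b if the comparison
is an ascent. Expanding, and cutting every path at the first place where b is chosen, gives Ψ_{u,v}
= Σ_x K_{u,x}(a - b) (δ_{x,v} + b Ψ_{x,v}), K_{u,x} = (R̃_{u,x} - δ_{u,x}) / q (`cdIndex_eq_sum`; Ψ
omits the empty path), so the polynomials R̃ determine the complete cd-index. They do not depend on
the ordering and satisfy R̃_{u,v} = R̃_{us,vs} + [u < us] q R̃_{u,vs} when vs < v. Both facts are
proved together by induction on ℓ(v), comparing an ordering with its conjugates
(`rPoly_eq_and_recursion`).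

Now let t be r or s and w = tvs. Only elements of the fibres {y, ty, ys, tys}, y ∈ P, contribute to
Ψ_{e,w} (`exists_fibre_of_cdHat_ne_zero`). Over y ≠ e the kernels between fibres are given in terms
of P by formulas that do not see whether t = r or t = s (`kernelPoly_fibre`). For t = s this needs
sy < sys, which holds because every generator is joined to s (`length_simple_mul_lt_conj`). A
triangular recursion (`cdHat_fibre_recursion`, `eq_of_kernel_recursion`) then makes all
contributions of these fibres agree for rvs and svs.

Only the fibre of e differs: {e, r, s, rs} against {e, s}, since ss = e. Expanding Ψ_{e,w} in both
cases in terms of p = Ψ_{e,v} and two sums common to both, the difference is (d - 1) p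
(`cdIndex_conj_add`). -/

noncomputable section

/-! ### Roots, reflections and length in a 3-complete Coxeter system. -/

namespace CoxeterMatrix

variable {B : Type*} {M : CoxeterMatrix B}

theorem IsThreeComplete.simpleCoroot_simpleRoot (hM : M.IsThreeComplete) {i j : B} (h : i ≠ j) :
    M.simpleCoroot i (simpleRoot j) = -1 := by
  rw [M.simpleCoroot_simpleRoot, hM i j h]
  norm_num [Real.cos_pi_div_three]

theorem rootForm_simpleRoot_left (i : B) (x : B →₀ ℝ) :
    M.rootForm (simpleRoot i) x = M.simpleCoroot i x := by
  simp [rootForm, simpleRoot]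

theorem simpleRoot_nonneg (i : B) : 0 ≤ simpleRoot i := by
  classical
  intro j
  simp only [simpleRoot, Finsupp.single_apply, Finsupp.coe_zero, Pi.zero_apply]
  split_ifs <;> norm_num

theorem simpleRoot_apply_self (i : B) : simpleRoot i i = 1 := by simp [simpleRoot]

theorem simpleRoot_apply_of_ne {i j : B} (h : i ≠ j) : simpleRoot i j = 0 := by
  simp [simpleRoot, h]

end CoxeterMatrix

namespace CoxeterSystem

open CoxeterMatrix

variable {B W : Type*} [Group W] {M : CoxeterMatrix B} (cs : CoxeterSystem M W)

theorem geomRep_simple_apply (i : B) (x : B →₀ ℝ) :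
    cs.geomRep (cs.simple i) x = x - M.simpleCoroot i x • simpleRoot i := by
  have : cs.geomRep (cs.simple i) = M.rootReflection i := cs.lift_apply_simple _ i
  rw [this, rootReflection, Module.reflection_apply]

theorem geomRep_mul_apply (w w' : W) (x : B →₀ ℝ) :
    cs.geomRep (w * w') x = cs.geomRep w (cs.geomRep w' x) := by
  rw [map_mul, LinearEquiv.mul_apply]

theorem geomRep_one_apply (x : B →₀ ℝ) : cs.geomRep 1 x = x := by
  rw [map_one]; rfl

theorem geomRep_inv_apply_self (w : W) (x : B →₀ ℝ) : cs.geomRep w⁻¹ (cs.geomRep w x) = x := by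
  rw [← geomRep_mul_apply, inv_mul_cancel, geomRep_one_apply]

theorem geomRep_apply_inv_self (w : W) (x : B →₀ ℝ) : cs.geomRep w (cs.geomRep w⁻¹ x) = x := by
  rw [← geomRep_mul_apply, mul_inv_cancel, geomRep_one_apply]

theorem geomRep_simple_self (i : B) :
    cs.geomRep (cs.simple i) (simpleRoot i) = -simpleRoot i := by
  rw [geomRep_simple_apply, M.simpleCoroot_self, two_smul]; abel

theorem geomRep_simple_apply_of_ne (i j : B) (h : i ≠ j) (x : B →₀ ℝ) :
    cs.geomRep (cs.simple i) x j = x j := by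
  simp [geomRep_simple_apply, simpleRoot_apply_of_ne h]

theorem geomRep_mul_simple_self (w : W) (i : B) :
    cs.geomRep (w * cs.simple i) (simpleRoot i) = -cs.geomRep w (simpleRoot i) := by
  rw [geomRep_mul_apply, geomRep_simple_self, map_neg]

/-- A root: the image of a simple root under some `w ∈ W`. -/
def IsRoot (β : B →₀ ℝ) : Prop := ∃ (w : W) (i : B), β = cs.geomRep w (simpleRoot i)

theorem isRoot_simpleRoot (i : B) : cs.IsRoot (simpleRoot i) :=
  ⟨1, i, (cs.geomRep_one_apply _).symm⟩

variable {cs}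

theorem IsRoot.geomRep {β : B →₀ ℝ} (h : cs.IsRoot β) (w : W) : cs.IsRoot (cs.geomRep w β) := by
  obtain ⟨u, i, rfl⟩ := h
  exact ⟨w * u, i, (cs.geomRep_mul_apply _ _ _).symm⟩

theorem IsRoot.rootForm_self {β : B →₀ ℝ} (h : cs.IsRoot β) : M.rootForm β β = 2 := by
  obtain ⟨w, i, rfl⟩ := h
  rw [rootForm_geomRep, rootForm_simpleRoot_left, M.simpleCoroot_self]

theorem IsRoot.ne_zero {β : B →₀ ℝ} (h : cs.IsRoot β) : β ≠ 0 := by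
  rintro rfl
  simpa using h.rootForm_self

variable (cs)

theorem geomRep_simple_simpleRoot (hM : M.IsThreeComplete) {i j : B} (h : i ≠ j) :
    cs.geomRep (cs.simple i) (simpleRoot j) = simpleRoot i + simpleRoot j := by
  rw [geomRep_simple_apply, hM.simpleCoroot_simpleRoot h]
  simp [add_comm]

theorem simple_braid (hM : M.IsThreeComplete) {i j : B} (h : i ≠ j) :
    cs.simple i * cs.simple j * cs.simple i = cs.simple j * cs.simple i * cs.simple j := by
  have h3 := cs.simple_mul_simple_pow i j
  rw [hM i j h, pow_succ, pow_two] at h3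
  have := eq_inv_of_mul_eq_one_left (a := cs.simple i * cs.simple j * cs.simple i)
    (b := cs.simple j * cs.simple i * cs.simple j) (by simpa only [mul_assoc] using h3)
  rw [this]
  simp [mul_assoc]

/-- Induction on length: with a right descent s_j and w = x s_j, the image is x(α_j) + x(α_i), where
only x(α_i) can fail to be nonnegative. In that case x = y s_i and the sum is y(α_j); the braid
relation excludes y s_j < y. -/
theorem geomRep_simpleRoot_nonneg (hM : M.IsThreeComplete) (w : W) (i : B)
    (h : cs.length w < cs.length (w * cs.simple i)) : 0 ≤ cs.geomRep w (simpleRoot i) := by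
  induction hn : cs.length w using Nat.strong_induction_on generalizing w i with
  | _ n ih =>
  subst hn
  rcases eq_or_ne w 1 with rfl | hw
  · rw [geomRep_one_apply]; exact simpleRoot_nonneg i
  obtain ⟨j, hj⟩ := cs.exists_rightDescent_of_ne_one hw
  have hj' : cs.length (w * cs.simple j) < cs.length w := hj
  have hij : j ≠ i := by rintro rfl; omega
  obtain ⟨x, rfl⟩ : ∃ x, w = x * cs.simple j := ⟨w * cs.simple j, by simp⟩
  rw [simple_mul_simple_cancel_right] at hj'
  rw [geomRep_mul_apply, cs.geomRep_simple_simpleRoot hM hij, map_add]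
  have h1 : 0 ≤ cs.geomRep x (simpleRoot j) := ih _ hj' x j hj' rfl
  by_cases hx : cs.length x < cs.length (x * cs.simple i)
  · exact add_nonneg h1 (ih _ hj' x i hx rfl)
  · have hx' : cs.length (x * cs.simple i) < cs.length x :=
      lt_of_le_of_ne (not_lt.1 hx) (cs.length_mul_simple_ne x i)
    obtain ⟨y, rfl⟩ : ∃ y, x = y * cs.simple i := ⟨x * cs.simple i, by simp⟩
    rw [simple_mul_simple_cancel_right] at hx'
    have hy : cs.length y < cs.length (y * cs.simple j) := by
      by_contra hy
      have hy' : cs.length (y * cs.simple j) < cs.length y :=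
        lt_of_le_of_ne (not_lt.1 hy) (cs.length_mul_simple_ne y j)
      obtain ⟨z, rfl⟩ : ∃ z, y = z * cs.simple j := ⟨y * cs.simple j, by simp⟩
      rw [simple_mul_simple_cancel_right] at hy'
      have e : z * cs.simple j * cs.simple i * cs.simple j * cs.simple i
          = z * cs.simple i * cs.simple j := by
        have := cs.simple_braid hM hij
        calc _ = z * (cs.simple j * cs.simple i * cs.simple j) * cs.simple i := by
              simp only [mul_assoc]
          _ = z * (cs.simple i * cs.simple j * cs.simple i) * cs.simple i := by rw [this]
          _ = _ := by simp [mul_assoc]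
      rw [e] at h
      have h2 := cs.length_mul_simple (z * cs.simple i) j
      have h3 := cs.length_mul_simple z i
      omega
    have := ih _ (hx'.trans hj') y j hy rfl
    rw [← map_add, geomRep_mul_apply, map_add, geomRep_simple_self,
      cs.geomRep_simple_simpleRoot hM hij.symm]
    simpa using this

theorem geomRep_simpleRoot_nonpos (hM : M.IsThreeComplete) (w : W) (i : B)
    (h : cs.length (w * cs.simple i) < cs.length w) : cs.geomRep w (simpleRoot i) ≤ 0 := by
  have := cs.geomRep_simpleRoot_nonneg hM (w * cs.simple i) i (by simpa using h)
  rw [geomRep_mul_simple_self] at this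
  simpa using this

variable {cs}

theorem IsRoot.nonneg_or_nonpos (hM : M.IsThreeComplete) {β : B →₀ ℝ} (h : cs.IsRoot β) :
    0 ≤ β ∨ β ≤ 0 := by
  obtain ⟨w, i, rfl⟩ := h
  rcases lt_or_gt_of_ne (cs.length_mul_simple_ne w i) with h | h
  · exact Or.inr (cs.geomRep_simpleRoot_nonpos hM w i h)
  · exact Or.inl (cs.geomRep_simpleRoot_nonneg hM w i h)

theorem IsRoot.not_nonneg_iff (hM : M.IsThreeComplete) {β : B →₀ ℝ} (h : cs.IsRoot β) :
    ¬ 0 ≤ β ↔ β ≤ 0 :=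
  ⟨(h.nonneg_or_nonpos hM).resolve_left, fun h1 h2 => h.ne_zero (le_antisymm h1 h2)⟩

theorem IsRoot.nonneg_of_apply_pos (hM : M.IsThreeComplete) {β : B →₀ ℝ} (h : cs.IsRoot β) (i : B)
    (hi : 0 < β i) : 0 ≤ β := by
  rcases h.nonneg_or_nonpos hM with h | h
  · exact h
  · exact absurd (h i) (not_le.2 hi)

variable (cs)

theorem geomRep_simpleRoot_nonneg_iff (hM : M.IsThreeComplete) (w : W) (i : B) :
    0 ≤ cs.geomRep w (simpleRoot i) ↔ cs.length w < cs.length (w * cs.simple i) := by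
  refine ⟨fun h => ?_, cs.geomRep_simpleRoot_nonneg hM w i⟩
  by_contra h'
  have h2 := cs.geomRep_simpleRoot_nonpos hM w i
    (lt_of_le_of_ne (not_lt.1 h') (cs.length_mul_simple_ne w i))
  exact IsRoot.ne_zero ⟨w, i, rfl⟩ (le_antisymm h2 h)

/-- The geometric representation is faithful. -/
theorem geomRep_injective (hM : M.IsThreeComplete) : Function.Injective cs.geomRep := by
  rw [injective_iff_map_eq_one]
  intro w hw
  by_contra h
  obtain ⟨j, hj⟩ := cs.exists_rightDescent_of_ne_one h
  have := cs.geomRep_simpleRoot_nonpos hM w j hj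
  rw [hw] at this
  have h2 := this j
  change simpleRoot j j ≤ 0 at h2
  rw [simpleRoot_apply_self] at h2
  norm_num at h2

variable {cs}

theorem IsRootOf.isRoot {t : W} {β : B →₀ ℝ} (h : cs.IsRootOf t β) : cs.IsRoot β := by
  obtain ⟨w, i, -, h⟩ := h
  exact ⟨w, i, h⟩

theorem IsRootOf.isReflection {t : W} {β : B →₀ ℝ} (h : cs.IsRootOf t β) : cs.IsReflection t := by
  obtain ⟨w, i, h, -⟩ := h
  exact ⟨w, i, h⟩

theorem IsRootOf.geomRep_apply {t : W} {β : B →₀ ℝ} (h : cs.IsRootOf t β) (x : B →₀ ℝ) :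
    cs.geomRep t x = x - M.rootForm β x • β := by
  obtain ⟨w, i, rfl, rfl⟩ := h
  rw [geomRep_mul_apply, geomRep_mul_apply, geomRep_simple_apply, map_sub, map_smul,
    geomRep_apply_inv_self, ← rootForm_simpleRoot_left, ← cs.rootForm_geomRep w,
    geomRep_apply_inv_self]

theorem IsRootOf.geomRep_self {t : W} {β : B →₀ ℝ} (h : cs.IsRootOf t β) :
    cs.geomRep t β = -β := by
  rw [h.geomRep_apply, h.isRoot.rootForm_self, two_smul]; abel

theorem IsRootOf.conj {t : W} {β : B →₀ ℝ} (h : cs.IsRootOf t β) (w : W) :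
    cs.IsRootOf (w * t * w⁻¹) (cs.geomRep w β) := by
  obtain ⟨u, i, rfl, rfl⟩ := h
  exact ⟨w * u, i, by simp [mul_assoc], (cs.geomRep_mul_apply _ _ _).symm⟩

theorem IsRootOf.reflection_unique (hM : M.IsThreeComplete) {t t' : W} {β : B →₀ ℝ}
    (h : cs.IsRootOf t β) (h' : cs.IsRootOf t' β) : t = t' := by
  apply cs.geomRep_injective hM
  ext1 x
  rw [h.geomRep_apply, h'.geomRep_apply]

/-- The reflection negates both roots, so they are proportional; equal norms leave the factor ±1,
and the signs of the coordinates exclude -1. -/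
theorem IsRootOf.root_unique {t : W} {β β' : B →₀ ℝ}
    (h : cs.IsRootOf t β) (h' : cs.IsRootOf t β') (hβ : 0 ≤ β) (hβ' : 0 ≤ β') : β = β' := by
  have h1 := h'.geomRep_self
  rw [h.geomRep_apply] at h1
  set c := M.rootForm β β'
  have h2 : c • β = (2 : ℝ) • β' := by
    rw [sub_eq_iff_eq_add] at h1
    rw [two_smul, ← sub_eq_zero]
    rw [eq_neg_add_iff_add_eq] at h1
    rw [h1]; simp
  have hc : c ^ 2 = 4 := by
    have h3 : M.rootForm (c • β) (c • β) = M.rootForm ((2 : ℝ) • β') ((2 : ℝ) • β') := by rw [h2]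
    simp only [map_smul, LinearMap.smul_apply, h.isRoot.rootForm_self, h'.isRoot.rootForm_self,
      smul_eq_mul] at h3
    nlinarith
  obtain ⟨i, hi⟩ := Finsupp.ne_iff.1 h.isRoot.ne_zero
  have hi' : 0 < β i := lt_of_le_of_ne (hβ i) (by simpa using hi.symm)
  have h4 : c * β i = 2 * β' i := by simpa using DFunLike.congr_fun h2 i
  have h5 : 0 ≤ β' i := hβ' i
  have h6 : 0 ≤ c := by
    by_contra h7
    nlinarith
  have h7 : c = 2 := by nlinarith
  rw [h7] at h2
  exact smul_right_injective _ (two_ne_zero (α := ℝ)) h2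

variable (cs)

theorem isRootOf_simple (i : B) : cs.IsRootOf (cs.simple i) (simpleRoot i) :=
  ⟨1, i, by simp, (cs.geomRep_one_apply _).symm⟩

variable {cs}

theorem IsReflection.exists_posRoot (hM : M.IsThreeComplete) {t : W} (h : cs.IsReflection t) :
    ∃ β : cs.posRoots, cs.IsRootOf t β := by
  obtain ⟨w, i, rfl⟩ := h
  rcases IsRoot.nonneg_or_nonpos hM (⟨w, i, rfl⟩ : cs.IsRoot (cs.geomRep w (simpleRoot i)))
    with h | h
  · exact ⟨⟨_, ⟨w, i, rfl⟩, h⟩, w, i, rfl, rfl⟩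
  · refine ⟨⟨cs.geomRep (w * cs.simple i) (simpleRoot i), ⟨_, i, rfl⟩, ?_⟩, w * cs.simple i, i,
      by simp [mul_assoc], rfl⟩
    rw [geomRep_mul_simple_self]
    exact neg_nonneg.2 h

/-- A simple reflection permutes the positive roots other than its simple root. -/
theorem IsRoot.geomRep_simple_nonneg (hM : M.IsThreeComplete) {β : B →₀ ℝ} (h : cs.IsRoot β)
    (hβ : 0 ≤ β) (i : B) (hi : β ≠ simpleRoot i) : 0 ≤ cs.geomRep (cs.simple i) β := by
  by_cases h0 : ∃ k, i ≠ k ∧ β k ≠ 0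
  · obtain ⟨k, hk, hk'⟩ := h0
    refine (h.geomRep _).nonneg_of_apply_pos hM k ?_
    rw [cs.geomRep_simple_apply_of_ne i k hk]
    exact lt_of_le_of_ne (hβ k) hk'.symm
  · push Not at h0
    exfalso
    -- A root supported on i alone is a multiple of α_i, and its norm forces the factor 1.
    have h1 : β = β i • simpleRoot i := by
      ext k
      rcases eq_or_ne i k with rfl | hk
      · simp [simpleRoot_apply_self]
      · simp [h0 k hk, simpleRoot_apply_of_ne hk]
    have h2 := h.rootForm_self
    rw [h1] at h2
    simp only [map_smul, LinearMap.smul_apply, rootForm_simpleRoot_left, M.simpleCoroot_self,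
      smul_eq_mul] at h2
    have h3 : 0 ≤ β i := hβ i
    have h4 : β i = 1 := by nlinarith
    rw [h4, one_smul] at h1
    exact hi h1

/-- Peel a right descent s_j off x. Unless β = α_j, the root s_j(β) is again positive and x s_j
sends it to x(β), so induction applies to the conjugate reflection. -/
theorem IsRootOf.length_mul_lt (hM : M.IsThreeComplete) {t : W} {β : B →₀ ℝ}
    (h : cs.IsRootOf t β) (hβ : 0 ≤ β) (x : W) (hx : cs.geomRep x β ≤ 0) :
    cs.length (x * t) < cs.length x := by
  induction hn : cs.length x using Nat.strong_induction_on generalizing x t β with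
  | _ n ih =>
  subst hn
  rcases eq_or_ne x 1 with rfl | hx1
  · rw [geomRep_one_apply] at hx
    exact absurd (le_antisymm hx hβ) h.isRoot.ne_zero
  obtain ⟨j, hj⟩ := cs.exists_rightDescent_of_ne_one hx1
  have hj : cs.length (x * cs.simple j) < cs.length x := hj
  by_cases hβj : β = simpleRoot j
  · rw [hβj] at h
    rwa [h.reflection_unique hM (cs.isRootOf_simple j)]
  · have h1 := ih _ hj (h.conj (cs.simple j)) (h.isRoot.geomRep_simple_nonneg hM hβ j hβj)
      (x * cs.simple j) (by
        rw [geomRep_mul_apply, ← cs.geomRep_mul_apply (cs.simple j)]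
        simpa [geomRep_one_apply])
      rfl
    have e : x * cs.simple j * (cs.simple j * t * (cs.simple j)⁻¹) = x * t * cs.simple j := by
      simp [mul_assoc]
    rw [e] at h1
    have h2 := cs.length_mul_simple (x * t) j
    have h3 := cs.length_mul_simple x j
    have h4 := h.isReflection.length_mul_left_ne x
    omega

theorem IsRootOf.length_lt_iff (hM : M.IsThreeComplete) {t : W} {β : B →₀ ℝ}
    (h : cs.IsRootOf t β) (hβ : 0 ≤ β) (x : W) :
    cs.length x < cs.length (x * t) ↔ 0 ≤ cs.geomRep x β := by
  constructor
  · intro h1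
    by_contra h2
    have := h.length_mul_lt hM hβ x (((h.isRoot.geomRep x).not_nonneg_iff hM).1 h2)
    omega
  · intro h1
    have := h.length_mul_lt hM hβ (x * t)
      (by rw [geomRep_mul_apply, h.geomRep_self, map_neg]; exact neg_nonpos.2 h1)
    rwa [mul_assoc, h.isReflection.mul_self, mul_one] at this

/-- Right multiplication by `s` preserves the direction of edges whose label is not `s`. -/
theorem IsReflection.length_lt_mul_simple_iff (hM : M.IsThreeComplete) {t : W}
    (h : cs.IsReflection t) (i : B) (ht : t ≠ cs.simple i) (x : W) :
    cs.length (x * cs.simple i) < cs.length (x * t * cs.simple i) ↔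
      cs.length x < cs.length (x * t) := by
  obtain ⟨β, hβ⟩ := h.exists_posRoot hM
  have hβi : β.1 ≠ simpleRoot i := by
    intro h1
    rw [h1] at hβ
    exact ht (hβ.reflection_unique hM (cs.isRootOf_simple i))
  rw [hβ.length_lt_iff hM β.2.2]
  have h1 := (hβ.conj (cs.simple i)).length_lt_iff hM
    (hβ.isRoot.geomRep_simple_nonneg hM β.2.2 i hβi) (x * cs.simple i)
  rw [geomRep_mul_apply, ← cs.geomRep_mul_apply (cs.simple i)] at h1
  simp only [simple_mul_simple_self, geomRep_one_apply] at h1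
  rw [← h1]
  simp [mul_assoc]

end CoxeterSystem
end

/-! ### Reflection orderings, their reverses and their conjugates. -/

noncomputable section

namespace CoxeterSystem

open CoxeterMatrix

variable {B W : Type*} [Group W] {M : CoxeterMatrix B} {cs : CoxeterSystem M W}

variable (cs) in
/-- The simple root `α_i` as a positive root. -/
def simplePosRoot (i : B) : cs.posRoots :=
  ⟨simpleRoot i, cs.isRoot_simpleRoot i, simpleRoot_nonneg i⟩

open scoped Classical in
/-- The involution of the positive roots that fixes `α_i` and maps `β ≠ α_i` to `s_i(β)`. -/
def reflectPosRoot (hM : M.IsThreeComplete) (i : B) (β : cs.posRoots) : cs.posRoots :=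
  if h : β.1 = simpleRoot i then β
  else ⟨cs.geomRep (cs.simple i) β.1, IsRoot.geomRep β.2.1 _,
    IsRoot.geomRep_simple_nonneg hM β.2.1 β.2.2 i h⟩

theorem coe_reflectPosRoot (hM : M.IsThreeComplete) (i : B) (β : cs.posRoots)
    (h : β ≠ cs.simplePosRoot i) :
    (reflectPosRoot hM i β : B →₀ ℝ) = cs.geomRep (cs.simple i) β.1 := by
  rw [reflectPosRoot, dif_neg]
  intro h'
  exact h (Subtype.ext h')

theorem reflectPosRoot_ne (hM : M.IsThreeComplete) (i : B) (β : cs.posRoots)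
    (h : β ≠ cs.simplePosRoot i) : reflectPosRoot hM i β ≠ cs.simplePosRoot i := by
  intro h'
  have h1 := congrArg Subtype.val h'
  rw [coe_reflectPosRoot hM i β h] at h1
  have h2 : β.1 = -simpleRoot i := by
    rw [← cs.geomRep_inv_apply_self (cs.simple i) β.1, h1, inv_simple]
    exact cs.geomRep_simple_self i
  have h3 : (0 : B →₀ ℝ) ≤ β.1 := β.2.2
  rw [h2] at h3
  exact (cs.isRoot_simpleRoot i).ne_zero (le_antisymm (neg_nonneg.1 h3) (simpleRoot_nonneg i))

theorem reflectPosRoot_reflectPosRoot (hM : M.IsThreeComplete) (i : B) (β : cs.posRoots) :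
    reflectPosRoot hM i (reflectPosRoot hM i β) = β := by
  by_cases h : β = cs.simplePosRoot i
  · have : reflectPosRoot hM i β = β := by
      rw [reflectPosRoot, dif_pos]
      rw [h]; rfl
    rw [this, this]
  · apply Subtype.ext
    rw [coe_reflectPosRoot hM i _ (reflectPosRoot_ne hM i β h), coe_reflectPosRoot hM i β h,
      ← geomRep_mul_apply, simple_mul_simple_self, geomRep_one_apply]

theorem reflectPosRoot_injective (hM : M.IsThreeComplete) (i : B) :
    Function.Injective (reflectPosRoot (cs := cs) hM i) :=
  Function.LeftInverse.injective (reflectPosRoot_reflectPosRoot hM i)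

/-- A simple root is not a positive combination of other positive roots. -/
theorem simplePosRoot_ne_combination (hM : M.IsThreeComplete) (i : B) (α β : cs.posRoots)
    (c₁ c₂ : ℝ) (h₁ : 0 < c₁) (h₂ : 0 < c₂) (hα : α ≠ cs.simplePosRoot i)
    (hβ : β ≠ cs.simplePosRoot i) :
    (cs.simplePosRoot i : B →₀ ℝ) ≠ c₁ • (α : B →₀ ℝ) + c₂ • (β : B →₀ ℝ) := by
  intro h
  have h3 := congrArg (cs.geomRep (cs.simple i)) h
  rw [map_add, map_smul, map_smul, ← coe_reflectPosRoot hM i α hα,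
    ← coe_reflectPosRoot hM i β hβ] at h3
  have h4 : (0 : B →₀ ℝ) ≤ c₁ • (reflectPosRoot hM i α : B →₀ ℝ)
      + c₂ • (reflectPosRoot hM i β : B →₀ ℝ) :=
    add_nonneg (smul_nonneg h₁.le (reflectPosRoot hM i α).2.2)
      (smul_nonneg h₂.le (reflectPosRoot hM i β).2.2)
  rw [← h3] at h4
  have h5 : (0 : B →₀ ℝ) ≤ -simpleRoot i := by
    rw [← cs.geomRep_simple_self i]
    exact h4
  exact (cs.isRoot_simpleRoot i).ne_zero (le_antisymm (neg_nonneg.1 h5) (simpleRoot_nonneg i))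

namespace ReflectionOrdering

variable (o : cs.ReflectionOrdering)

theorem lt_trans {α β γ : cs.posRoots} (h : o.lt α β) (h' : o.lt β γ) : o.lt α γ :=
  o.isStrictTotalOrder.trans _ _ _ h h'

theorem lt_irrefl (α : cs.posRoots) : ¬ o.lt α α := o.isStrictTotalOrder.irrefl α

theorem lt_asymm {α β : cs.posRoots} (h : o.lt α β) : ¬ o.lt β α :=
  fun h' => o.lt_irrefl _ (o.lt_trans h h')

theorem lt_trichotomy (α β : cs.posRoots) : o.lt α β ∨ α = β ∨ o.lt β α := by
  by_contra h
  push Not at h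
  exact h.2.1 (o.isStrictTotalOrder.trichotomous _ _ h.1 h.2.2)

/-- The opposite reflection ordering. -/
def rev : cs.ReflectionOrdering where
  lt α β := o.lt β α
  isStrictTotalOrder :=
    { trichotomous := fun a b h1 h2 => o.isStrictTotalOrder.trichotomous a b h2 h1
      irrefl := fun a => o.lt_irrefl a
      trans := fun _ _ _ h h' => o.lt_trans h' h }
  between := fun α β γ c₁ c₂ h₁ h₂ hγ h =>
    (o.between β α γ c₂ c₁ h₂ h₁ (by rw [hγ, add_comm]) h).symm

/-- The roots β and s_i(β) differ by a multiple of α_i. If they are distinct, one of them is a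
positive combination of the other and α_i, hence lies between these two; so s_i moves no root across
α_i. -/
theorem reflectPosRoot_lt (hM : M.IsThreeComplete) {i : B} {β : cs.posRoots}
    (h : o.lt β (cs.simplePosRoot i)) : o.lt (reflectPosRoot hM i β) (cs.simplePosRoot i) := by
  have hne : β ≠ cs.simplePosRoot i := by rintro rfl; exact o.lt_irrefl _ h
  have hne' := reflectPosRoot_ne hM i β hne
  have hr := coe_reflectPosRoot hM i β hne
  rw [geomRep_simple_apply] at hr
  set c := M.simpleCoroot i β.1
  rcases _root_.lt_trichotomy c 0 with hc | hc | hc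
  · exact (o.between β (cs.simplePosRoot i) (reflectPosRoot hM i β) 1 (-c) one_pos (by linarith)
      (by rw [hr, one_smul, neg_smul, ← sub_eq_add_neg]; rfl) h).2
  · have : reflectPosRoot hM i β = β := Subtype.ext (by rw [hr, hc, zero_smul, sub_zero])
    rwa [this]
  · rcases o.lt_trichotomy (reflectPosRoot hM i β) (cs.simplePosRoot i) with h' | h' | h'
    · exact h'
    · exact absurd h' hne'
    · have := (o.between _ _ β c 1 hc one_pos
        (by rw [hr, one_smul]; exact (add_sub_cancel _ _).symm) h').1
      exact absurd this (o.lt_asymm h)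

theorem lt_reflectPosRoot (hM : M.IsThreeComplete) {i : B} {β : cs.posRoots}
    (h : o.lt (cs.simplePosRoot i) β) : o.lt (cs.simplePosRoot i) (reflectPosRoot hM i β) :=
  o.rev.reflectPosRoot_lt hM h

/-- The relation of the upper `s_i`-conjugate of an ordering: the positive roots preceding `α_i`
keep their order, those following `α_i` are ordered through `s_i`, and `α_i` becomes the last. -/
def upperConjLT (hM : M.IsThreeComplete) (i : B) (α β : cs.posRoots) : Prop :=
  (o.lt α (cs.simplePosRoot i) ∧ (o.lt β (cs.simplePosRoot i) → o.lt α β)) ∨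
    (o.lt (cs.simplePosRoot i) α ∧ ((o.lt (cs.simplePosRoot i) β ∧
      o.lt (reflectPosRoot hM i α) (reflectPosRoot hM i β)) ∨ β = cs.simplePosRoot i))

theorem upperConjLT_trichotomous (hM : M.IsThreeComplete) (i : B) (α β : cs.posRoots) :
    o.upperConjLT hM i α β ∨ α = β ∨ o.upperConjLT hM i β α := by
  unfold upperConjLT
  rcases o.lt_trichotomy α (cs.simplePosRoot i) with ha | ha | ha <;>
  rcases o.lt_trichotomy β (cs.simplePosRoot i) with hb | hb | hb
  · rcases o.lt_trichotomy α β with h | h | h <;> simp [*]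
  · subst hb; simp [ha, o.lt_irrefl]
  · simp [ha, o.lt_asymm hb]
  · subst ha; simp [hb, o.lt_irrefl]
  · simp [ha, hb]
  · subst ha; simp [hb]
  · simp [hb, o.lt_asymm ha]
  · simp [ha, hb]
  · rcases o.lt_trichotomy (reflectPosRoot hM i α) (reflectPosRoot hM i β) with h | h | h
    · simp [*]
    · simp [reflectPosRoot_injective hM i h]
    · simp [*]

theorem upperConjLT_irrefl (hM : M.IsThreeComplete) (i : B) (α : cs.posRoots) :
    ¬ o.upperConjLT hM i α α := by
  rintro (⟨h, h'⟩ | ⟨h, ⟨-, h'⟩ | h'⟩)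
  · exact o.lt_irrefl _ (h' h)
  · exact o.lt_irrefl _ h'
  · subst h'; exact o.lt_irrefl _ h

theorem upperConjLT_trans (hM : M.IsThreeComplete) (i : B) (α β γ : cs.posRoots)
    (h : o.upperConjLT hM i α β) (h' : o.upperConjLT hM i β γ) : o.upperConjLT hM i α γ := by
  rcases h with ⟨h1, h2⟩ | ⟨h1, ⟨h2, h3⟩ | h2⟩ <;> rcases h' with ⟨k1, k2⟩ | ⟨k1, ⟨k2, k3⟩ | k2⟩
  · exact Or.inl ⟨h1, fun h => o.lt_trans (h2 k1) (k2 h)⟩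
  · exact Or.inl ⟨h1, fun h => absurd h (o.lt_asymm k2)⟩
  · subst k2; exact Or.inl ⟨h1, fun h => absurd h (o.lt_irrefl _)⟩
  · exact absurd k1 (o.lt_asymm h2)
  · exact Or.inr ⟨h1, Or.inl ⟨k2, o.lt_trans h3 k3⟩⟩
  · exact Or.inr ⟨h1, Or.inr k2⟩
  · subst h2; exact absurd k1 (o.lt_irrefl _)
  · subst h2; exact absurd k1 (o.lt_irrefl _)
  · exact Or.inr ⟨h1, Or.inr k2⟩

/-- The upper `s_i`-conjugate of a reflection ordering. -/
def upperConj (hM : M.IsThreeComplete) (i : B) : cs.ReflectionOrdering where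
  lt := o.upperConjLT hM i
  isStrictTotalOrder :=
    { trichotomous := fun a b h1 h2 =>
        ((o.upperConjLT_trichotomous hM i a b).resolve_left h1).resolve_right h2
      irrefl := o.upperConjLT_irrefl hM i
      trans := o.upperConjLT_trans hM i }
  between := by
    intro α β γ c₁ c₂ h₁ h₂ hγ h
    have refl_comb (hα : α ≠ cs.simplePosRoot i) (hβ : β ≠ cs.simplePosRoot i)
        (hγ' : γ ≠ cs.simplePosRoot i) : (reflectPosRoot hM i γ : B →₀ ℝ) =
          c₁ • (reflectPosRoot hM i α : B →₀ ℝ) + c₂ • (reflectPosRoot hM i β : B →₀ ℝ) := by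
      rw [coe_reflectPosRoot hM i α hα, coe_reflectPosRoot hM i β hβ,
        coe_reflectPosRoot hM i γ hγ', hγ, map_add, map_smul, map_smul]
    have ne_of_lt {δ} (h : o.lt δ (cs.simplePosRoot i)) : δ ≠ cs.simplePosRoot i := by
      rintro rfl; exact o.lt_irrefl _ h
    have ne_of_gt {δ} (h : o.lt (cs.simplePosRoot i) δ) : δ ≠ cs.simplePosRoot i := by
      rintro rfl; exact o.lt_irrefl _ h
    rcases h with ⟨h1, h2⟩ | ⟨h1, ⟨h2, h3⟩ | h2⟩
    · rcases o.lt_trichotomy β (cs.simplePosRoot i) with hb | hb | hb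
      · obtain ⟨k1, k2⟩ := o.between α β γ c₁ c₂ h₁ h₂ hγ (h2 hb)
        exact ⟨Or.inl ⟨h1, fun _ => k1⟩, Or.inl ⟨o.lt_trans k2 hb, fun _ => k2⟩⟩
      · subst hb
        obtain ⟨k1, k2⟩ := o.between α _ γ c₁ c₂ h₁ h₂ hγ h1
        exact ⟨Or.inl ⟨h1, fun _ => k1⟩, Or.inl ⟨k2, fun h => absurd h (o.lt_irrefl _)⟩⟩
      · obtain ⟨k1, k2⟩ := o.between α β γ c₁ c₂ h₁ h₂ hγ (o.lt_trans h1 hb)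
        rcases o.lt_trichotomy γ (cs.simplePosRoot i) with hc | hc | hc
        · exact ⟨Or.inl ⟨h1, fun _ => k1⟩, Or.inl ⟨hc, fun h => absurd h (o.lt_asymm hb)⟩⟩
        -- Here γ = α_i would be a positive combination of two other positive roots.
        · exfalso
          refine simplePosRoot_ne_combination hM i α β c₁ c₂ h₁ h₂ (ne_of_lt h1) (ne_of_gt hb) ?_
          rw [← hc, hγ]
        · refine ⟨Or.inl ⟨h1, fun _ => k1⟩, Or.inr ⟨hc, Or.inl ⟨hb, ?_⟩⟩⟩
          exact (o.between _ _ _ c₁ c₂ h₁ h₂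
            (refl_comb (ne_of_lt h1) (ne_of_gt hb) (ne_of_gt hc))
            (o.lt_trans (o.reflectPosRoot_lt hM h1) (o.lt_reflectPosRoot hM hb))).2
    · have hc : o.lt (cs.simplePosRoot i) γ := by
        rcases o.lt_trichotomy α β with hab | hab | hab
        · exact o.lt_trans h1 (o.between α β γ c₁ c₂ h₁ h₂ hγ hab).1
        · subst hab; exact absurd h3 (o.lt_irrefl _)
        · exact o.lt_trans h2 (o.between β α γ c₂ c₁ h₂ h₁ (by rw [hγ, add_comm]) hab).1
      obtain ⟨k1, k2⟩ := o.between _ _ _ c₁ c₂ h₁ h₂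
        (refl_comb (ne_of_gt h1) (ne_of_gt h2) (ne_of_gt hc)) h3
      exact ⟨Or.inr ⟨h1, Or.inl ⟨hc, k1⟩⟩, Or.inr ⟨hc, Or.inl ⟨h2, k2⟩⟩⟩
    · subst h2
      have hc := (o.between _ α γ c₂ c₁ h₂ h₁ (by rw [hγ, add_comm]) h1).1
      refine ⟨Or.inr ⟨h1, Or.inl ⟨hc, ?_⟩⟩, Or.inr ⟨hc, Or.inr rfl⟩⟩
      -- Solving s_i(γ) = c₁ s_i(α) - c₂ α_i for s_i(α) exhibits it as a positive combination of α_i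
      -- and s_i(γ), so it precedes s_i(γ).
      refine (o.between _ _ _ (c₂ / c₁) (1 / c₁) (by positivity) (by positivity) ?_
        (o.lt_reflectPosRoot hM hc)).2
      rw [coe_reflectPosRoot hM i γ (ne_of_gt hc), coe_reflectPosRoot hM i α (ne_of_gt h1), hγ,
        map_add, map_smul, map_smul]
      change _ = _ + (1 / c₁) • (_ + c₂ • cs.geomRep (cs.simple i) (simpleRoot i))
      rw [geomRep_simple_self]
      change _ = (c₂ / c₁) • simpleRoot i + _
      rw [smul_add, smul_smul, smul_smul, one_div_mul_cancel h₁.ne', one_smul, smul_neg,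
        one_div_mul_eq_div]
      abel

variable {o}

theorem reflLT_iff {t t' : W} {β β' : cs.posRoots}
    (h : cs.IsRootOf t β) (h' : cs.IsRootOf t' β') : o.reflLT t t' ↔ o.lt β β' := by
  constructor
  · rintro ⟨γ, γ', k, k', hlt⟩
    rwa [Subtype.ext (h.root_unique k β.2.2 γ.2.2), Subtype.ext (h'.root_unique k' β'.2.2 γ'.2.2)]
  · exact fun hlt => ⟨β, β', h, h', hlt⟩

variable (o)

theorem reflLT_trans {t t' t'' : W} (h : o.reflLT t t')
    (h' : o.reflLT t' t'') : o.reflLT t t'' := by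
  obtain ⟨β, β', k, k', hlt⟩ := h
  obtain ⟨γ', γ, l', l, hlt'⟩ := h'
  exact ⟨β, γ, k, l, o.lt_trans hlt (by
    rwa [Subtype.ext (k'.root_unique l' β'.2.2 γ'.2.2)])⟩

theorem reflLT_irrefl (t : W) : ¬ o.reflLT t t := by
  rintro ⟨β, β', k, k', hlt⟩
  rw [Subtype.ext (k'.root_unique k β'.2.2 β.2.2)] at hlt
  exact o.lt_irrefl _ hlt

theorem reflLT_asymm {t t' : W} (h : o.reflLT t t') : ¬ o.reflLT t' t :=
  fun h' => o.reflLT_irrefl _ (o.reflLT_trans h h')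

theorem reflLT_trichotomy (hM : M.IsThreeComplete) {t t' : W} (h : cs.IsReflection t)
    (h' : cs.IsReflection t') : o.reflLT t t' ∨ t = t' ∨ o.reflLT t' t := by
  obtain ⟨β, hβ⟩ := h.exists_posRoot hM
  obtain ⟨β', hβ'⟩ := h'.exists_posRoot hM
  rw [reflLT_iff hβ hβ', reflLT_iff hβ' hβ]
  rcases o.lt_trichotomy β β' with k | k | k
  · exact Or.inl k
  · subst k; exact Or.inr (Or.inl (hβ.reflection_unique hM hβ'))
  · exact Or.inr (Or.inr k)

theorem rev_reflLT {t t' : W} : o.rev.reflLT t t' ↔ o.reflLT t' t :=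
  ⟨fun ⟨β, β', k, k', h⟩ => ⟨β', β, k', k, h⟩, fun ⟨β, β', k, k', h⟩ => ⟨β', β, k', k, h⟩⟩

theorem isRootOf_conj_simple (hM : M.IsThreeComplete) {i : B} {t : W} {β : cs.posRoots}
    (h : cs.IsRootOf t β) (ht : t ≠ cs.simple i) :
    cs.IsRootOf (cs.simple i * t * cs.simple i) (reflectPosRoot hM i β) := by
  rw [coe_reflectPosRoot hM i β]
  · simpa using h.conj (cs.simple i)
  · rintro rfl
    exact ht (h.reflection_unique hM (cs.isRootOf_simple i))

variable {i : B} {t t' : W}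

theorem reflLT_left (h : o.reflLT t t') : cs.IsReflection t := by
  obtain ⟨β, -, k, -⟩ := h
  exact k.isReflection

theorem reflLT_right (h : o.reflLT t t') : cs.IsReflection t' := by
  obtain ⟨-, β, -, k, -⟩ := h
  exact k.isReflection

theorem simple_reflLT_conj (hM : M.IsThreeComplete) (h : o.reflLT (cs.simple i) t) :
    o.reflLT (cs.simple i) (cs.simple i * t * cs.simple i) := by
  have ht : t ≠ cs.simple i := by rintro rfl; exact o.reflLT_irrefl _ h
  obtain ⟨β, hβ⟩ := (o.reflLT_right h).exists_posRoot hM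
  have hi : cs.IsRootOf (cs.simple i) (cs.simplePosRoot i) := cs.isRootOf_simple i
  rw [reflLT_iff hi hβ] at h
  rw [reflLT_iff hi (isRootOf_conj_simple hM hβ ht)]
  exact o.lt_reflectPosRoot hM h

theorem upperConj_reflLT_simple (hM : M.IsThreeComplete) (h : cs.IsReflection t)
    (ht : t ≠ cs.simple i) : (o.upperConj hM i).reflLT t (cs.simple i) := by
  obtain ⟨β, hβ⟩ := h.exists_posRoot hM
  have hi : cs.IsRootOf (cs.simple i) (cs.simplePosRoot i) := cs.isRootOf_simple i
  rw [reflLT_iff hβ hi]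
  rcases o.reflLT_trichotomy hM h (cs.isReflection_simple i) with k | k | k
  · rw [reflLT_iff hβ hi] at k
    exact Or.inl ⟨k, fun h => absurd h (o.lt_irrefl _)⟩
  · exact absurd k ht
  · rw [reflLT_iff hi hβ] at k
    exact Or.inr ⟨k, Or.inr rfl⟩

theorem upperConj_reflLT_of_lt (hM : M.IsThreeComplete) (h : o.reflLT t (cs.simple i))
    (h' : o.reflLT t' (cs.simple i)) : (o.upperConj hM i).reflLT t t' ↔ o.reflLT t t' := by
  obtain ⟨β, hβ⟩ := (o.reflLT_left h).exists_posRoot hM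
  obtain ⟨β', hβ'⟩ := (o.reflLT_left h').exists_posRoot hM
  have hi : cs.IsRootOf (cs.simple i) (cs.simplePosRoot i) := cs.isRootOf_simple i
  rw [reflLT_iff hβ hi] at h
  rw [reflLT_iff hβ' hi] at h'
  rw [reflLT_iff hβ hβ', reflLT_iff hβ hβ']
  simp [upperConj, upperConjLT, h, h', o.lt_asymm h]

theorem upperConj_reflLT_of_lt_of_gt (hM : M.IsThreeComplete) (h : o.reflLT t (cs.simple i))
    (h' : o.reflLT (cs.simple i) t') : (o.upperConj hM i).reflLT t t' := by
  obtain ⟨β, hβ⟩ := (o.reflLT_left h).exists_posRoot hM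
  obtain ⟨β', hβ'⟩ := (o.reflLT_right h').exists_posRoot hM
  have hi : cs.IsRootOf (cs.simple i) (cs.simplePosRoot i) := cs.isRootOf_simple i
  rw [reflLT_iff hβ hi] at h
  rw [reflLT_iff hi hβ'] at h'
  rw [reflLT_iff hβ hβ']
  exact Or.inl ⟨h, fun k => absurd k (o.lt_asymm h')⟩

theorem upperConj_reflLT_of_gt (hM : M.IsThreeComplete) (h : o.reflLT (cs.simple i) t)
    (h' : o.reflLT (cs.simple i) t') : (o.upperConj hM i).reflLT t t' ↔
      o.reflLT (cs.simple i * t * cs.simple i) (cs.simple i * t' * cs.simple i) := by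
  have ht : t ≠ cs.simple i := by rintro rfl; exact o.reflLT_irrefl _ h
  have ht' : t' ≠ cs.simple i := by rintro rfl; exact o.reflLT_irrefl _ h'
  obtain ⟨β, hβ⟩ := (o.reflLT_right h).exists_posRoot hM
  obtain ⟨β', hβ'⟩ := (o.reflLT_right h').exists_posRoot hM
  have hi : cs.IsRootOf (cs.simple i) (cs.simplePosRoot i) := cs.isRootOf_simple i
  rw [reflLT_iff hi hβ] at h
  rw [reflLT_iff hi hβ'] at h'
  rw [reflLT_iff hβ hβ', reflLT_iff (isRootOf_conj_simple hM hβ ht)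
    (isRootOf_conj_simple hM hβ' ht')]
  have hne : β' ≠ cs.simplePosRoot i := by rintro rfl; exact o.lt_irrefl _ h'
  simp [upperConj, upperConjLT, h, h', o.lt_asymm h, hne]

end ReflectionOrdering

end CoxeterSystem
end

/-! ### Generating polynomials of paths with increasing labels. -/

noncomputable section

namespace CoxeterSystem

open CoxeterMatrix Polynomial

variable {B W : Type*} [Finite B] [Group W] {M : CoxeterMatrix B} (cs : CoxeterSystem M W)

/-- The finite set of all elements of length at most `n`. -/
def lengthLE (n : ℕ) : Finset W := (cs.finite_setOf_length_le n).toFinset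

variable {cs} in
theorem mem_lengthLE {n : ℕ} {x : W} : x ∈ cs.lengthLE n ↔ cs.length x ≤ n := by
  simp [lengthLE]

open scoped Classical in
/-- Auxiliary to `incPoly`: only paths with at most `n` edges are counted. -/
def incPolyAux (lt : W → W → Prop) : ℕ → Set W → W → W → ℤ[X]
  | 0, _, u, v => if u = v then 1 else 0
  | n + 1, A, u, v => (if u = v then 1 else 0) + X * ∑ z ∈ cs.lengthLE (cs.length v),
      if u⁻¹ * z ∈ A ∧ cs.length u < cs.length z then
        incPolyAux lt n {t | t ∈ A ∧ lt (u⁻¹ * z) t} z v else 0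

/-- The generating polynomial, by number of edges, of the length-increasing paths from `u` to `v`
whose labels `x_{i-1}⁻¹ x_i` belong to `A` and increase with respect to `lt`. -/
def incPoly (lt : W → W → Prop) (A : Set W) (u v : W) : ℤ[X] :=
  cs.incPolyAux lt (cs.length v) A u v

variable {cs} {lt lt' : W → W → Prop}

open scoped Classical in
theorem incPolyAux_of_length_le {n : ℕ} {A : Set W} {u v : W} (h : cs.length v ≤ cs.length u) :
    cs.incPolyAux lt n A u v = if u = v then 1 else 0 := by
  cases n with
  | zero => rfl
  | succ n =>
    rw [incPolyAux, Finset.sum_eq_zero, mul_zero, add_zero]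
    intro z hz
    rw [mem_lengthLE] at hz
    rw [if_neg]
    rintro ⟨-, h'⟩
    omega

/-- Every edge raises the length, so a path from u to v has at most ℓ(v) - ℓ(u) edges and any larger
bound is harmless. -/
theorem incPolyAux_stable {n m : ℕ} {A : Set W} {u v : W} (hn : cs.length v ≤ n + cs.length u)
    (hm : cs.length v ≤ m + cs.length u) :
    cs.incPolyAux lt n A u v = cs.incPolyAux lt m A u v := by
  classical
  by_cases h : cs.length v ≤ cs.length u
  · rw [incPolyAux_of_length_le h, incPolyAux_of_length_le h]
  induction n generalizing m A u with
  | zero => omega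
  | succ n ih =>
    cases m with
    | zero => omega
    | succ m =>
      rw [incPolyAux, incPolyAux]
      congr 2
      refine Finset.sum_congr rfl fun z _ => ?_
      split_ifs with hz
      · by_cases hzv : cs.length v ≤ cs.length z
        · rw [incPolyAux_of_length_le hzv, incPolyAux_of_length_le hzv]
        · exact ih (by omega) (by omega) hzv
      · rfl

open scoped Classical in
theorem incPoly_of_length_le {A : Set W} {u v : W} (h : cs.length v ≤ cs.length u) :
    cs.incPoly lt A u v = if u = v then 1 else 0 :=
  incPolyAux_of_length_le h

theorem incPoly_self (A : Set W) (u : W) : cs.incPoly lt A u u = 1 := by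
  rw [incPoly_of_length_le le_rfl, if_pos rfl]

theorem incPoly_eq_zero {A : Set W} {u v : W} (h : cs.length v ≤ cs.length u) (h' : u ≠ v) :
    cs.incPoly lt A u v = 0 := by
  rw [incPoly_of_length_le h, if_neg h']

theorem incPoly_eq_zero_of_lt {A : Set W} {u v : W} (h : cs.length v < cs.length u) :
    cs.incPoly lt A u v = 0 :=
  incPoly_eq_zero h.le (by rintro rfl; exact lt_irrefl _ h)

open scoped Classical in
-- Vertices longer than v contribute nothing. The freedom in `S` lets sums with different endpoints
-- share one index set.
theorem incPoly_eq {A : Set W} {u v : W} {S : Finset W} (hS : cs.lengthLE (cs.length v) ⊆ S) :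
    cs.incPoly lt A u v = (if u = v then 1 else 0) + X * ∑ z ∈ S,
      if u⁻¹ * z ∈ A ∧ cs.length u < cs.length z then
        cs.incPoly lt {t | t ∈ A ∧ lt (u⁻¹ * z) t} z v else 0 := by
  rw [incPoly, incPolyAux_stable (m := cs.length v + 1) (by omega) (by omega), incPolyAux]
  congr 2
  refine Finset.sum_subset_zero_on_sdiff hS ?_ fun _ _ => rfl
  intro z hz
  rw [Finset.mem_sdiff, mem_lengthLE] at hz
  split_ifs
  · exact incPoly_eq_zero_of_lt (by omega)
  · rfl

theorem incPoly_congr {A : Set W} (h : ∀ t ∈ A, ∀ t' ∈ A, lt t t' ↔ lt' t t') (u v : W) :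
    cs.incPoly lt A u v = cs.incPoly lt' A u v := by
  classical
  induction hn : cs.length v - cs.length u using Nat.strong_induction_on generalizing u A with
  | _ n ih =>
  subst hn
  by_cases hle : cs.length v ≤ cs.length u
  · rw [incPoly_of_length_le hle, incPoly_of_length_le hle]
  rw [incPoly_eq subset_rfl, incPoly_eq subset_rfl]
  congr 2
  refine Finset.sum_congr rfl fun z _ => ?_
  split_ifs with hz
  · have e : {t | t ∈ A ∧ lt (u⁻¹ * z) t} = {t | t ∈ A ∧ lt' (u⁻¹ * z) t} := by
      ext t
      exact and_congr_right fun ht => h _ hz.1 _ ht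
    rw [← e]
    exact ih _ (by omega) (fun t ht t' ht' => h t ht.1 t' ht'.1) z rfl
  · rfl

/-- All of A₁ precedes all of A₂, so an increasing path has a unique vertex x at which its labels
pass from A₁ to A₂. -/
theorem incPoly_union {A₁ A₂ : Set W} (h : ∀ t ∈ A₁, ∀ t' ∈ A₂, lt t t' ∧ ¬ lt t' t ∧ t ≠ t')
    {u v : W} {S : Finset W} (hS : cs.lengthLE (cs.length v) ⊆ S) :
    cs.incPoly lt (A₁ ∪ A₂) u v = ∑ x ∈ S, cs.incPoly lt A₁ u x * cs.incPoly lt A₂ x v := by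
  classical
  have key : ∀ u, cs.incPoly lt (A₁ ∪ A₂) u v =
      ∑ x ∈ cs.lengthLE (cs.length v), cs.incPoly lt A₁ u x * cs.incPoly lt A₂ x v := by
    intro u
    induction hn : cs.length v - cs.length u using Nat.strong_induction_on generalizing u A₁ with
    | _ n ih =>
    subst hn
    have e (x) (hx : x ∈ cs.lengthLE (cs.length v)) :
        cs.incPoly lt A₁ u x * cs.incPoly lt A₂ x v =
        (if u = x then cs.incPoly lt A₂ x v else 0) + X * ∑ z ∈ cs.lengthLE (cs.length v),
          if u⁻¹ * z ∈ A₁ ∧ cs.length u < cs.length z then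
            cs.incPoly lt {t | t ∈ A₁ ∧ lt (u⁻¹ * z) t} z x * cs.incPoly lt A₂ x v else 0 := by
      rw [incPoly_eq (S := cs.lengthLE (cs.length v)), add_mul, mul_assoc, Finset.sum_mul]
      · simp only [ite_mul, one_mul, zero_mul]
      · intro y hy
        rw [mem_lengthLE] at *
        exact hy.trans hx
    rw [Finset.sum_congr rfl e, Finset.sum_add_distrib, ← Finset.mul_sum, Finset.sum_comm,
      incPoly_eq (S := cs.lengthLE (cs.length v)) subset_rfl, Finset.sum_ite_eq]
    have hu : (if u ∈ cs.lengthLE (cs.length v) then cs.incPoly lt A₂ u v else 0) =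
        cs.incPoly lt A₂ u v := by
      split_ifs with hu
      · rfl
      · rw [mem_lengthLE, not_le] at hu
        rw [incPoly_eq_zero_of_lt hu]
    rw [hu, incPoly_eq (A := A₂) (S := cs.lengthLE (cs.length v)) subset_rfl, add_assoc, ← mul_add,
      ← Finset.sum_add_distrib]
    congr 2
    refine Finset.sum_congr rfl fun z hz => ?_
    rw [mem_lengthLE] at hz
    by_cases h0 : cs.length u < cs.length z
    · by_cases h1 : u⁻¹ * z ∈ A₁
      · have h2 : u⁻¹ * z ∉ A₂ := fun h2 => (h _ h1 _ h2).2.2 rfl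
        simp only [Set.mem_union, h0, h1, h2, true_or, and_true, if_true, if_false, zero_add]
        rw [← ih _ (by omega) (A₁ := {t | t ∈ A₁ ∧ lt (u⁻¹ * z) t})
          (fun t ht t' ht' => h t ht.1 t' ht') z rfl]
        congr 1
        ext t
        constructor
        · rintro ⟨ht | ht, h3⟩
          · exact Or.inl ⟨ht, h3⟩
          · exact Or.inr ht
        · rintro (⟨ht, h3⟩ | ht)
          · exact ⟨Or.inl ht, h3⟩
          · exact ⟨Or.inr ht, (h _ h1 _ ht).1⟩
      -- If the first label is in A₂, the cut is at u and no later label can return to A₁.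
      · by_cases h2 : u⁻¹ * z ∈ A₂
        · simp only [Set.mem_union, h0, h1, h2, or_true, and_true, if_true, if_false,
            Finset.sum_const_zero, add_zero]
          congr 1
          ext t
          constructor
          · rintro ⟨ht | ht, h3⟩
            · exact absurd h3 (h _ ht _ h2).2.1
            · exact ⟨ht, h3⟩
          · rintro ⟨ht, h3⟩
            exact ⟨Or.inr ht, h3⟩
        · simp [h1, h2]
    · simp [h0]
  rw [key]
  refine Finset.sum_subset hS fun x _ hx => ?_
  rw [mem_lengthLE, not_le] at hx
  rw [incPoly_eq_zero_of_lt (cs := cs) (A := A₂) hx, mul_zero]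

/-- A finite set containing all elements up to a given length and stable under right
multiplication by a simple reflection. -/
theorem exists_finset_mul_simple_mem_iff (n : ℕ) (i : B) :
    ∃ S : Finset W, cs.lengthLE n ⊆ S ∧ ∀ x, x * cs.simple i ∈ S ↔ x ∈ S := by
  classical
  refine ⟨cs.lengthLE n ∪ (cs.lengthLE n).image (· * cs.simple i), Finset.subset_union_left,
    fun x => ?_⟩
  have key (x) : x ∈ (cs.lengthLE n).image (· * cs.simple i) ↔ x * cs.simple i ∈ cs.lengthLE n := by
    rw [Finset.mem_image]
    constructor
    · rintro ⟨y, hy, rfl⟩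
      simpa using hy
    · exact fun h => ⟨_, h, by simp⟩
  rw [Finset.mem_union, Finset.mem_union, key, key, simple_mul_simple_cancel_right, or_comm]

/-- Multiplying all vertices on the right by s_i conjugates the labels by s_i, and it preserves the
direction of the edges because no label equals s_i. -/
theorem incPoly_conj (hM : M.IsThreeComplete) {A : Set W} (i : B)
    (hA : ∀ t ∈ A, cs.IsReflection t ∧ t ≠ cs.simple i)
    (h : ∀ t ∈ A, ∀ t' ∈ A, lt' t t' ↔
      lt (cs.simple i * t * cs.simple i) (cs.simple i * t' * cs.simple i)) (u v : W) :
    cs.incPoly lt' A u v = cs.incPoly lt {t | cs.simple i * t * cs.simple i ∈ A}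
      (u * cs.simple i) (v * cs.simple i) := by
  classical
  -- The induction must reach vertices z of length ℓ(v) + 1, since z s_i may still be shorter than v
  -- s_i. For longer z both sides vanish.
  induction hn : cs.length v + 2 - cs.length u using Nat.strong_induction_on generalizing u A with
  | _ n ih =>
  subst hn
  obtain ⟨S, hS, hSi⟩ := cs.exists_finset_mul_simple_mem_iff (cs.length v + 1) i
  have hS1 : cs.lengthLE (cs.length v) ⊆ S := fun x hx => hS (by
    rw [mem_lengthLE] at *; omega)
  have hS2 : cs.lengthLE (cs.length (v * cs.simple i)) ⊆ S := fun x hx => hS (by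
    rw [mem_lengthLE] at *; have := cs.length_mul_simple v i; omega)
  rw [incPoly_eq hS1, incPoly_eq hS2]
  congr 1
  · simp
  congr 1
  refine Finset.sum_nbij' (· * cs.simple i) (· * cs.simple i) (fun x hx => (hSi x).2 hx)
    (fun x hx => (hSi x).2 hx) (fun x _ => by simp) (fun x _ => by simp) fun z hz => ?_
  have e1 : cs.simple i * ((u * cs.simple i)⁻¹ * (z * cs.simple i)) * cs.simple i = u⁻¹ * z := by
    simp [mul_assoc]
  have e2 : (u * cs.simple i)⁻¹ * (z * cs.simple i)
      = cs.simple i * (u⁻¹ * z) * cs.simple i := by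
    simp [mul_assoc]
  by_cases h1 : u⁻¹ * z ∈ A
  · have h2 := (hA _ h1).1.length_lt_mul_simple_iff hM i (hA _ h1).2 u
    rw [mul_inv_cancel_left] at h2
    simp only [Set.mem_ofPred_eq, e1, h1, h2, true_and]
    split_ifs with h3
    · by_cases hz : cs.length z ≤ cs.length v + 1
      · rw [ih _ (by omega) (A := {t | t ∈ A ∧ lt' (u⁻¹ * z) t}) (fun t ht => hA t ht.1)
          (fun t ht t' ht' => h t ht.1 t' ht'.1) z rfl]
        congr 1
        ext t
        simp only [Set.mem_ofPred_eq]
        refine and_congr_right fun ht => ?_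
        rw [h _ h1 _ ht, e2]
        simp [mul_assoc]
      · rw [incPoly_eq_zero_of_lt (by omega), incPoly_of_length_le, if_neg]
        · intro h4
          rw [mul_left_inj] at h4
          subst h4
          omega
        · have := cs.length_mul_simple z i
          have := cs.length_mul_simple v i
          omega
    · rfl
  · simp only [Set.mem_ofPred_eq, e1, h1, false_and, if_false]

open scoped Classical in
-- Increasing labels do not repeat, so such a path has at most one edge.
theorem incPoly_singleton (i : B) (h : ¬ lt (cs.simple i) (cs.simple i)) (u v : W) :
    cs.incPoly lt {cs.simple i} u v = (if u = v then 1 else 0) +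
      if cs.length (v * cs.simple i) < cs.length v ∧ u = v * cs.simple i then X else 0 := by
  rw [incPoly_eq subset_rfl]
  congr 1
  have e (z) : u⁻¹ * z ∈ ({cs.simple i} : Set W) ↔ z = u * cs.simple i := by
    rw [Set.mem_singleton_iff, inv_mul_eq_iff_eq_mul]
  have e2 : {t | t ∈ ({cs.simple i} : Set W) ∧ lt (cs.simple i) t} = ∅ := by
    ext t
    simp only [Set.mem_singleton_iff, Set.mem_ofPred_eq, Set.mem_empty_iff_false, iff_false]
    rintro ⟨rfl, h'⟩
    exact h h'
  have e3 (z) : cs.incPoly lt ∅ z v = if z = v then 1 else 0 := by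
    rw [incPoly_eq subset_rfl]; simp
  trans X * ∑ z ∈ cs.lengthLE (cs.length v), if z = v then
      (if v = u * cs.simple i ∧ cs.length u < cs.length v then 1 else 0) else 0
  · congr 1
    refine Finset.sum_congr rfl fun z _ => ?_
    by_cases hz : z = u * cs.simple i
    · have hz' : u⁻¹ * z = cs.simple i := by rw [hz]; simp
      rw [hz', e2, e3]
      simp only [Set.mem_singleton_iff, true_and]
      by_cases hzv : z = v
      · subst hzv
        simp [hz]
      · simp [hzv]
    · rw [if_neg (by rw [e]; exact fun h => hz h.1)]
      by_cases hzv : z = v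
      · subst hzv; simp [hz]
      · simp [hzv]
  rw [Finset.sum_ite_eq', if_pos (mem_lengthLE.2 le_rfl)]
  have e5 : (v = u * cs.simple i ∧ cs.length u < cs.length v) ↔
      (cs.length (v * cs.simple i) < cs.length v ∧ u = v * cs.simple i) := by
    constructor
    · rintro ⟨rfl, h⟩; simpa using h
    · rintro ⟨h, rfl⟩; simpa using h
  simp only [e5]
  split_ifs <;> simp

open scoped Classical in
theorem sum_mul_incPoly_singleton (i : B) (h : ¬ lt (cs.simple i) (cs.simple i)) (f : W → ℤ[X])
    (v : W) : ∑ x ∈ cs.lengthLE (cs.length v), f x * cs.incPoly lt {cs.simple i} x v =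
      f v + if cs.length (v * cs.simple i) < cs.length v then X * f (v * cs.simple i) else 0 := by
  simp only [incPoly_singleton i h, mul_add, Finset.sum_add_distrib, mul_ite, mul_one, mul_zero,
    Finset.sum_ite_eq', mem_lengthLE, le_refl, if_true]
  congr 1
  split_ifs with h'
  · simp only [h', true_and, Finset.sum_ite_eq', mem_lengthLE, h'.le, if_true]
    ring
  · simp [h']

open scoped Classical in
theorem sum_incPoly_singleton_mul (i : B) (h : ¬ lt (cs.simple i) (cs.simple i)) (f : W → ℤ[X])
    (n : ℕ) (hf : ∀ x, n < cs.length x → f x = 0) (u : W) :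
    ∑ x ∈ cs.lengthLE n, cs.incPoly lt {cs.simple i} u x * f x =
      f u + if cs.length u < cs.length (u * cs.simple i) then X * f (u * cs.simple i) else 0 := by
  have e (x) : (cs.length (x * cs.simple i) < cs.length x ∧ u = x * cs.simple i) ↔
      x = u * cs.simple i ∧ cs.length u < cs.length (u * cs.simple i) := by
    constructor
    · rintro ⟨h, rfl⟩; simpa using h
    · rintro ⟨rfl, h⟩; simpa using h
  simp only [incPoly_singleton i h, add_mul, Finset.sum_add_distrib, ite_mul, one_mul, zero_mul,
    Finset.sum_ite_eq, e, ite_and, Finset.sum_ite_eq']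
  congr 1
  · split_ifs with h'
    · rfl
    · rw [mem_lengthLE, not_le] at h'
      rw [hf u h']
  · split_ifs with h1 h2 h2
    · rfl
    · rfl
    · rw [mem_lengthLE, not_le] at h1
      rw [hf _ h1, mul_zero]
    · rfl

end CoxeterSystem
end

/-! ### The R̃-polynomials: independence of the ordering and recursion. -/

noncomputable section

namespace CoxeterSystem

open CoxeterMatrix Polynomial

variable {B W : Type*} [Group W] {M : CoxeterMatrix B} {cs : CoxeterSystem M W}

namespace ReflectionOrdering

/-- The reflections following the simple reflection `s_i`. -/
def upper (o : cs.ReflectionOrdering) (i : B) : Set W := {t | o.reflLT (cs.simple i) t}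

/-- The reflections preceding the simple reflection `s_i`. -/
def lower (o : cs.ReflectionOrdering) (i : B) : Set W := {t | o.reflLT t (cs.simple i)}

variable (o : cs.ReflectionOrdering)

theorem isReflection_eq_union (hM : M.IsThreeComplete) (i : B) :
    {t | cs.IsReflection t} = o.lower i ∪ ({cs.simple i} ∪ o.upper i) := by
  ext t
  constructor
  · intro ht
    rcases o.reflLT_trichotomy hM ht (cs.isReflection_simple i) with h | h | h
    · exact Or.inl h
    · exact Or.inr (Or.inl h)
    · exact Or.inr (Or.inr h)
  · rintro (h | rfl | h)
    · exact o.reflLT_left h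
    · exact cs.isReflection_simple i
    · exact o.reflLT_right h

theorem ne_simple_of_mem_upper {i : B} {t : W} (h : t ∈ o.upper i) : t ≠ cs.simple i := by
  rintro rfl; exact o.reflLT_irrefl _ h

theorem conj_mem_upper_iff (hM : M.IsThreeComplete) (i : B) (t : W) :
    cs.simple i * t * cs.simple i ∈ o.upper i ↔ t ∈ o.upper i := by
  constructor
  · intro h
    have := o.simple_reflLT_conj hM h
    have e : cs.simple i * (cs.simple i * t * cs.simple i) * cs.simple i = t := by
      simp [mul_assoc]
    rwa [e] at this
  · exact o.simple_reflLT_conj hM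

end ReflectionOrdering

variable [Finite B]

/-- The matrix of increasing-path polynomials is unitriangular with respect to length, hence can be
cancelled. -/
theorem eq_of_sum_incPoly_mul_eq {lt : W → W → Prop} {A : Set W} {n : ℕ} {f g : W → ℤ[X]}
    (h : ∀ u, ∑ x ∈ cs.lengthLE n, cs.incPoly lt A u x * f x =
      ∑ x ∈ cs.lengthLE n, cs.incPoly lt A u x * g x) (u : W) (hu : cs.length u ≤ n) :
    f u = g u := by
  classical
  induction hn : n - cs.length u using Nat.strong_induction_on generalizing u with
  | _ m ih =>
  subst hn
  have h1 := h u
  have hmem : u ∈ cs.lengthLE n := mem_lengthLE.2 hu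
  rw [← Finset.add_sum_erase _ _ hmem, ← Finset.add_sum_erase _ _ hmem, incPoly_self, one_mul,
    one_mul] at h1
  have h2 : ∑ x ∈ (cs.lengthLE n).erase u, cs.incPoly lt A u x * f x =
      ∑ x ∈ (cs.lengthLE n).erase u, cs.incPoly lt A u x * g x := by
    refine Finset.sum_congr rfl fun x hx => ?_
    rw [Finset.mem_erase, mem_lengthLE] at hx
    by_cases hxu : cs.length x ≤ cs.length u
    · rw [incPoly_eq_zero hxu hx.1.symm, zero_mul, zero_mul]
    · rw [ih _ (by omega) x hx.2 rfl]
  rw [h2] at h1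
  exact add_right_cancel h1

namespace ReflectionOrdering

/-- Dyer's polynomial `R̃_{u,v}`, as the generating polynomial of increasing Bruhat paths. -/
def rPoly (o : cs.ReflectionOrdering) (u v : W) : ℤ[X] :=
  cs.incPoly o.reflLT {t | cs.IsReflection t} u v

variable (o : cs.ReflectionOrdering)

open scoped Classical in
-- An increasing path uses labels below s_i up to some x, then possibly s_i itself, then labels
-- above s_i.
theorem rPoly_eq_sum (hM : M.IsThreeComplete) (i : B) (u v : W) :
    o.rPoly u v = ∑ x ∈ cs.lengthLE (cs.length v), cs.incPoly o.reflLT (o.lower i) u x *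
      (cs.incPoly o.reflLT (o.upper i) x v + if cs.length x < cs.length (x * cs.simple i) then
        X * cs.incPoly o.reflLT (o.upper i) (x * cs.simple i) v else 0) := by
  rw [rPoly, o.isReflection_eq_union hM i, incPoly_union ?_ subset_rfl]
  · refine Finset.sum_congr rfl fun x _ => ?_
    rw [incPoly_union ?_ subset_rfl, sum_incPoly_singleton_mul i (o.reflLT_irrefl _)
      (fun x => cs.incPoly o.reflLT (o.upper i) x v) _ fun x hx => incPoly_eq_zero_of_lt hx]
    rintro _ rfl t ht
    exact ⟨ht, o.reflLT_asymm ht, (o.ne_simple_of_mem_upper ht).symm⟩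
  · rintro t ht t' (rfl | ht')
    · exact ⟨ht, o.reflLT_asymm ht, by rintro rfl; exact o.reflLT_irrefl _ ht⟩
    · have := o.reflLT_trans ht ht'
      exact ⟨this, o.reflLT_asymm this, by rintro rfl; exact o.reflLT_irrefl _ this⟩

theorem incPoly_upperConj_upper (hM : M.IsThreeComplete) (i : B) (x w : W) :
    cs.incPoly (o.upperConj hM i).reflLT (o.upper i) x w =
      cs.incPoly o.reflLT (o.upper i) (x * cs.simple i) (w * cs.simple i) := by
  rw [incPoly_conj (lt := o.reflLT) hM i]
  · congr 1
    ext t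
    exact o.conj_mem_upper_iff hM i t
  · exact fun t ht => ⟨o.reflLT_right ht, o.ne_simple_of_mem_upper ht⟩
  · exact fun t ht t' ht' => o.upperConj_reflLT_of_gt hM ht ht'

open scoped Classical in
-- In the upper conjugate the labels below s_i still come first and in the same order, then those
-- above, compared through s_i, and s_i is last. Right multiplication by s_i turns the middle
-- stretch into one for the original ordering.
theorem rPoly_upperConj_eq_sum (hM : M.IsThreeComplete) (i : B) (u v : W) :
    (o.upperConj hM i).rPoly u v =
      ∑ x ∈ cs.lengthLE (cs.length v), cs.incPoly o.reflLT (o.lower i) u x *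
        (cs.incPoly o.reflLT (o.upper i) (x * cs.simple i) (v * cs.simple i) +
          if cs.length (v * cs.simple i) < cs.length v then
            X * cs.incPoly o.reflLT (o.upper i) (x * cs.simple i) v else 0) := by
  have hF := o.incPoly_upperConj_upper hM i
  rw [rPoly, o.isReflection_eq_union hM i, Set.union_comm {cs.simple i},
    incPoly_union ?_ subset_rfl]
  · refine Finset.sum_congr rfl fun x _ => ?_
    rw [incPoly_congr (lt' := o.reflLT) (A := o.lower i)
        fun t ht t' ht' => o.upperConj_reflLT_of_lt hM ht ht',
      incPoly_union ?_ subset_rfl, sum_mul_incPoly_singleton i (reflLT_irrefl _ _), hF, hF,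
      simple_mul_simple_cancel_right]
    rintro t ht _ rfl
    have := o.upperConj_reflLT_simple hM (o.reflLT_right ht) (o.ne_simple_of_mem_upper ht)
    exact ⟨this, reflLT_asymm _ this, o.ne_simple_of_mem_upper ht⟩
  · rintro t ht t' (ht' | rfl)
    · have := o.upperConj_reflLT_of_lt_of_gt hM ht ht'
      exact ⟨this, reflLT_asymm _ this, by rintro rfl; exact reflLT_irrefl _ _ this⟩
    · have hne : t ≠ cs.simple i := by rintro rfl; exact reflLT_irrefl _ _ ht
      have := o.upperConj_reflLT_simple hM (o.reflLT_left ht) hne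
      exact ⟨this, reflLT_asymm _ this, hne⟩

/-- The two expansions share the unitriangular factor of the lower labels. Cancelling it in the
equality for w = v s_i relates the upper paths to w and to v (`key`); this relation at x and at x
s_i gives the equality for v. -/
theorem rPoly_upperConj (hM : M.IsThreeComplete) (i : B) (v : W)
    (hv : cs.length (v * cs.simple i) < cs.length v)
    (h : ∀ u, o.rPoly u (v * cs.simple i) = (o.upperConj hM i).rPoly u (v * cs.simple i)) (u : W) :
    o.rPoly u v = (o.upperConj hM i).rPoly u v := by
  classical
  set w := v * cs.simple i with hw
  have hws : w * cs.simple i = v := by simp [hw]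
  set F := cs.incPoly o.reflLT (o.upper i) with hF
  have key : ∀ u, F u w + (if cs.length u < cs.length (u * cs.simple i) then
      X * F (u * cs.simple i) w else 0) = F (u * cs.simple i) v := by
    intro u
    by_cases hu : cs.length u ≤ cs.length w
    · have := eq_of_sum_incPoly_mul_eq (cs := cs) (lt := o.reflLT) (A := o.lower i)
        (n := cs.length w)
        (f := fun u => F u w + (if cs.length u < cs.length (u * cs.simple i) then
          X * F (u * cs.simple i) w else 0))
        (g := fun u => F (u * cs.simple i) (w * cs.simple i) +
          if cs.length (w * cs.simple i) < cs.length w then X * F (u * cs.simple i) w else 0)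
        (fun u => by
          rw [← o.rPoly_eq_sum hM i u w, ← o.rPoly_upperConj_eq_sum hM i u w, h u]) u hu
      simpa only [hws, if_neg (not_lt.2 hv.le), add_zero] using this
    · rw [← hws, hF, ← o.incPoly_upperConj_upper hM i u w, incPoly_eq_zero_of_lt (not_le.1 hu),
        incPoly_eq_zero_of_lt (not_le.1 hu), zero_add]
      split_ifs
      · rw [incPoly_eq_zero_of_lt (cs := cs) (u := u * cs.simple i) (v := w) (by omega), mul_zero]
      · rfl
  rw [o.rPoly_eq_sum hM i, o.rPoly_upperConj_eq_sum hM i]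
  refine Finset.sum_congr rfl fun x _ => ?_
  congr 1
  rw [if_pos hv, ← hw, ← hF]
  have k1 := key x
  have k2 := key (x * cs.simple i)
  rw [simple_mul_simple_cancel_right] at k2
  have h1 := cs.length_mul_simple_ne x i
  split_ifs with h2
  · rw [if_neg (not_lt.2 h2.le), add_zero] at k2
    rw [← k2]
  · rw [if_pos (by omega)] at k2
    rw [if_neg h2, add_zero] at k1
    rw [← k1, ← k2, add_zero]

open scoped Classical in
-- With s_i last, an edge labelled s_i can only end a path. The ordering `(o.rev.upperConj hM
-- i).rev` has s_i first and compares the other labels through s_i. Equating the two expansions at v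
-- s_i gives `key`, whose instances at u and u s_i yield the recursion.
theorem rPoly_recursion_of_simple_last (hM : M.IsThreeComplete) (i : B)
    (ho : ∀ t, cs.IsReflection t → t ≠ cs.simple i → o.reflLT t (cs.simple i)) (v : W)
    (hv : cs.length (v * cs.simple i) < cs.length v)
    (h : ∀ u, o.rPoly u (v * cs.simple i) =
      (o.rev.upperConj hM i).rev.rPoly u (v * cs.simple i)) (u : W) :
    o.rPoly u v = o.rPoly (u * cs.simple i) (v * cs.simple i) +
      if cs.length u < cs.length (u * cs.simple i) then X * o.rPoly u (v * cs.simple i) else 0 := by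
  set w := v * cs.simple i with hw
  have hws : w * cs.simple i = v := by simp [hw]
  set A : Set W := {t | cs.IsReflection t ∧ t ≠ cs.simple i} with hA
  have hT : {t | cs.IsReflection t} = A ∪ {cs.simple i} := by
    ext t
    by_cases ht : t = cs.simple i
    · simp [ht, cs.isReflection_simple]
    · simp [ht, A]
  have hAi (t : W) : cs.simple i * t * cs.simple i ∈ A ↔ t ∈ A := by
    have h1 := cs.isReflection_conj_iff (cs.simple i) t
    rw [inv_simple] at h1
    simp only [A, Set.mem_ofPred_eq, h1]
    have : cs.simple i * t * cs.simple i = cs.simple i ↔ t = cs.simple i := by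
      constructor
      · intro h
        have := congrArg (fun x => cs.simple i * x * cs.simple i) h
        simpa [mul_assoc] using this
      · rintro rfl; simp
    simp only [ne_eq, this]
  set P := cs.incPoly o.reflLT A with hP
  have e1 (u v : W) : o.rPoly u v = P u v +
      if cs.length (v * cs.simple i) < cs.length v then X * P u (v * cs.simple i) else 0 := by
    rw [rPoly, hT, incPoly_union ?_ subset_rfl, sum_mul_incPoly_singleton i (o.reflLT_irrefl _)]
    rintro t ht _ rfl
    have := ho t ht.1 ht.2
    exact ⟨this, o.reflLT_asymm this, ht.2⟩
  have hlt (t : W) (ht : t ∈ A) : o.rev.reflLT (cs.simple i) t := (o.rev_reflLT).2 (ho t ht.1 ht.2)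
  have e2 (u v : W) : cs.incPoly (o.rev.upperConj hM i).rev.reflLT A u v =
      P (u * cs.simple i) (v * cs.simple i) := by
    rw [incPoly_conj (lt := o.reflLT) (A := A) hM i (fun t ht => ht)]
    · congr 1
      ext t
      exact hAi t
    · intro t ht t' ht'
      rw [rev_reflLT, upperConj_reflLT_of_gt _ hM (hlt _ ht') (hlt _ ht), rev_reflLT]
  have e3 (u v : W) : (o.rev.upperConj hM i).rev.rPoly u v =
      P (u * cs.simple i) (v * cs.simple i) +
      if cs.length u < cs.length (u * cs.simple i) then X * P u (v * cs.simple i) else 0 := by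
    rw [rPoly, hT, Set.union_comm, incPoly_union ?_ subset_rfl, sum_incPoly_singleton_mul i
      (reflLT_irrefl _ _) _ _ fun x hx => incPoly_eq_zero_of_lt hx, e2, e2,
      simple_mul_simple_cancel_right]
    rintro _ rfl t ht
    have := (rev_reflLT _).2
      (o.rev.upperConj_reflLT_simple hM ht.1 ht.2)
    exact ⟨this, reflLT_asymm _ this, ht.2.symm⟩
  have key (u : W) : P u w = P (u * cs.simple i) v +
      if cs.length u < cs.length (u * cs.simple i) then X * P u v else 0 := by
    have := h u
    rw [e1, e3, hws, if_neg (not_lt.2 hv.le), add_zero] at this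
    exact this
  have e4 (u : W) : o.rPoly u w = P u w := by
    rw [e1, hws, if_neg (not_lt.2 hv.le), add_zero]
  rw [e1 u v, if_pos hv, ← hw, e4, e4]
  have k1 := key u
  have k2 := key (u * cs.simple i)
  rw [simple_mul_simple_cancel_right] at k2
  have h1 := cs.length_mul_simple_ne u i
  rw [k2]
  by_cases h2 : cs.length u < cs.length (u * cs.simple i)
  · rw [if_pos h2, if_neg (not_lt.2 h2.le), add_zero]
  · rw [if_neg h2, if_pos (by omega), k1, if_neg h2, add_zero, add_zero]

open scoped Classical in
-- Simultaneous induction on ℓ(v). Independence at v s_i gives the recursion at v, by passing to the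
-- upper conjugate, where s_i is last. The recursion expresses R̃ at v through R̃ at v s_i, so
-- independence follows at v.
theorem rPoly_eq_and_recursion (hM : M.IsThreeComplete) (v : W) :
    (∀ (o o' : cs.ReflectionOrdering) (u : W), o.rPoly u v = o'.rPoly u v) ∧
    ∀ (o : cs.ReflectionOrdering) (i : B) (u : W), cs.length (v * cs.simple i) < cs.length v →
      o.rPoly u v = o.rPoly (u * cs.simple i) (v * cs.simple i) +
      if cs.length u < cs.length (u * cs.simple i) then
        X * o.rPoly u (v * cs.simple i) else 0 := by
  induction hn : cs.length v using Nat.strong_induction_on generalizing v with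
  | _ n ih =>
  subst hn
  have hrec : ∀ (o : cs.ReflectionOrdering) (i : B) (u : W),
      cs.length (v * cs.simple i) < cs.length v →
      o.rPoly u v = o.rPoly (u * cs.simple i) (v * cs.simple i) +
      if cs.length u < cs.length (u * cs.simple i) then
        X * o.rPoly u (v * cs.simple i) else 0 := by
    intro o i u hv
    have h := (ih _ hv _ rfl).1
    rw [o.rPoly_upperConj hM i v hv (fun u => h _ _ u) u,
      rPoly_recursion_of_simple_last _ hM i
        (fun t ht ht' => o.upperConj_reflLT_simple hM ht ht') v hv (fun u => h _ _ u) u,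
      h (o.upperConj hM i) o, h (o.upperConj hM i) o]
  refine ⟨fun o o' u => ?_, fun o i u hi => hrec o i u hi⟩
  rcases eq_or_ne v 1 with rfl | hv
  · rw [rPoly, rPoly, incPoly_of_length_le (by simp), incPoly_of_length_le (by simp)]
  · obtain ⟨i, hi⟩ := cs.exists_rightDescent_of_ne_one hv
    have hi : cs.length (v * cs.simple i) < cs.length v := hi
    have h := (ih _ hi _ rfl).1
    rw [hrec o i u hi, hrec o' i u hi, h o o', h o o']

/-- `R̃_{u,v}` does not depend on the reflection ordering. -/
theorem rPoly_eq (hM : M.IsThreeComplete) (o o' : cs.ReflectionOrdering) (u v : W) :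
    o.rPoly u v = o'.rPoly u v :=
  (rPoly_eq_and_recursion hM v).1 o o' u

open scoped Classical in
theorem rPoly_recursion (hM : M.IsThreeComplete) (o : cs.ReflectionOrdering) (i : B) (u : W)
    {v : W} (hv : cs.length (v * cs.simple i) < cs.length v) :
    o.rPoly u v = o.rPoly (u * cs.simple i) (v * cs.simple i) +
      if cs.length u < cs.length (u * cs.simple i) then X * o.rPoly u (v * cs.simple i) else 0 :=
  (rPoly_eq_and_recursion hM v).2 o i u hv

end ReflectionOrdering

end CoxeterSystem
end

/-! ### The complete cd-index in terms of the R̃-polynomials. -/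

noncomputable section

namespace CoxeterSystem

open CoxeterMatrix Polynomial CompleteCD

variable {B W : Type*} [Group W] {M : CoxeterMatrix B} {cs : CoxeterSystem M W}

theorem bruhatEdge_iff {u z : W} :
    cs.BruhatEdge u z ↔ cs.IsReflection (u⁻¹ * z) ∧ cs.length u < cs.length z := by
  constructor
  · rintro ⟨t, ht, rfl, h⟩
    refine ⟨?_, h⟩
    have := ht.conj u⁻¹
    simpa [mul_assoc] using this
  · rintro ⟨h1, h2⟩
    refine ⟨z * u⁻¹, ?_, by simp, h2⟩
    have := h1.conj u
    simpa [mul_assoc] using this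

theorem mem_bruhatPaths_iff {u v : W} {p : List W} :
    p ∈ cs.bruhatPaths u v ↔ (u = v ∧ p = [u]) ∨
      ∃ z, cs.BruhatEdge u z ∧ ∃ q ∈ cs.bruhatPaths z v, p = u :: q := by
  constructor
  · rintro ⟨hc, hh, hl⟩
    rcases p with _ | ⟨x, q⟩
    · simp at hh
    obtain rfl : x = u := by simpa using hh
    rcases q with _ | ⟨z, q⟩
    · exact Or.inl ⟨by simpa using hl, rfl⟩
    · rw [List.isChain_cons_cons] at hc
      exact Or.inr ⟨z, hc.1, z :: q, ⟨hc.2, rfl, by simpa using hl⟩, rfl⟩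
  · rintro (⟨rfl, rfl⟩ | ⟨z, hz, q, ⟨hc, hh, hl⟩, rfl⟩)
    · exact ⟨by simp, rfl, rfl⟩
    · rcases q with _ | ⟨x, q⟩
      · simp at hh
      obtain rfl : x = z := by simpa using hh
      exact ⟨List.isChain_cons_cons.2 ⟨hz, hc⟩, rfl, by simpa using hl⟩

theorem length_le_of_mem_bruhatPaths {u v : W} {p : List W} (h : p ∈ cs.bruhatPaths u v) :
    cs.length u ≤ cs.length v := by
  induction p generalizing u with
  | nil => simp [bruhatPaths] at h
  | cons x q ih =>
    rcases mem_bruhatPaths_iff.1 h with ⟨rfl, -⟩ | ⟨z, hz, q', hq', h'⟩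
    · rfl
    · obtain ⟨rfl, rfl⟩ := List.cons.inj h'
      exact (bruhatEdge_iff.1 hz).2.le.trans (ih hq')

variable [Finite B]

variable (cs) in
/-- The finite set of Bruhat paths from `u` to `v`. -/
def pathFinset (u v : W) : Finset (List W) := (cs.bruhatPaths_finite u v).toFinset

theorem mem_pathFinset {u v : W} {p : List W} : p ∈ cs.pathFinset u v ↔ p ∈ cs.bruhatPaths u v := by
  simp [pathFinset]

theorem pathFinset_eq_empty {u v : W} (h : cs.length v < cs.length u) :
    cs.pathFinset u v = ∅ := by
  rw [Finset.eq_empty_iff_forall_notMem]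
  intro p hp
  exact absurd (length_le_of_mem_bruhatPaths (mem_pathFinset.1 hp)) (not_le.2 h)

open scoped Classical in
/-- Decomposition of a sum over Bruhat paths according to the first edge. -/
theorem sum_pathFinset {R : Type*} [AddCommMonoid R] (f : List W → R) (u v : W) {S : Finset W}
    (hS : cs.lengthLE (cs.length v) ⊆ S) :
    ∑ p ∈ cs.pathFinset u v, f p = (if u = v then f [u] else 0) +
      ∑ z ∈ S, if cs.BruhatEdge u z then ∑ p ∈ cs.pathFinset z v, f (u :: p) else 0 := by
  have e : cs.pathFinset u v = (if u = v then {[u]} else ∅) ∪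
      (S.filter (cs.BruhatEdge u)).biUnion fun z => (cs.pathFinset z v).image (u :: ·) := by
    ext p
    rw [mem_pathFinset, mem_bruhatPaths_iff, Finset.mem_union, Finset.mem_biUnion]
    refine or_congr (by split_ifs with h <;> simp [h]) (exists_congr fun z => ?_)
    simp only [Finset.mem_filter, Finset.mem_image, mem_pathFinset]
    constructor
    · rintro ⟨hz, q, hq, rfl⟩
      exact ⟨⟨hS (mem_lengthLE.2 (length_le_of_mem_bruhatPaths hq)), hz⟩, q, hq, rfl⟩
    · rintro ⟨⟨-, hz⟩, q, hq, rfl⟩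
      exact ⟨hz, q, hq, rfl⟩
  have hne {z q} (h : q ∈ cs.bruhatPaths z v) : q.head? = some z := h.2.1
  rw [e, Finset.sum_union, Finset.sum_biUnion]
  · congr 1
    · split_ifs <;> simp
    · rw [Finset.sum_filter]
      refine Finset.sum_congr rfl fun z _ => ?_
      rw [Finset.sum_image fun x _ y _ h => (List.cons.inj h).2]
  · intro z _ z' _ hzz'
    rw [Function.onFun, Finset.disjoint_left]
    intro p hp hp'
    simp only [Finset.mem_image, mem_pathFinset] at hp hp'
    obtain ⟨q, hq, rfl⟩ := hp
    obtain ⟨q', hq', h⟩ := hp'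
    obtain rfl := (List.cons.inj h).2
    exact hzz' (Option.some.inj ((hne hq).symm.trans (hne hq')))
  · rw [Finset.disjoint_left]
    intro p hp hp'
    simp only [Finset.mem_biUnion, Finset.mem_image, mem_pathFinset] at hp'
    obtain ⟨z, -, q, hq, rfl⟩ := hp'
    split_ifs at hp
    · have : q = [] := by simpa using hp
      subst this
      simpa using hne hq
    · simp at hp

namespace ReflectionOrdering

variable (o : cs.ReflectionOrdering)

/-- The evaluation of polynomials at `a - b`. -/
def evalSub : ℤ[X] →ₐ[ℤ] ABPoly := aeval (a - b)

theorem evalSub_X : evalSub X = a - b := aeval_X _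

/-- The sum of the monomials of the Bruhat paths from `u` to `v`, preceded by an edge with
label `t`. -/
def cdFrom (t u v : W) : ABPoly :=
  ∑ p ∈ cs.pathFinset u v, pathMonomial o ((u * t⁻¹) :: p)

open scoped Classical in
/-- The complete `cd`-index `Ψ̃_{u,v}`, without the empty path. -/
def cdIndex (u v : W) : ABPoly := completeCDIndex o u v - if u = v then 1 else 0

open scoped Classical in
/-- `1 + b Ψ̃_{v,v}` or `b Ψ̃_{u,v}`, depending on whether `u = v`. -/
def cdHat (u v : W) : ABPoly := (if u = v then 1 else 0) + b * o.cdIndex u v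

theorem completeCDIndex_of_ne {u v : W} (h : u ≠ v) : completeCDIndex o u v = o.cdIndex u v := by
  rw [cdIndex, if_neg h, sub_zero]

open scoped Classical in
theorem cdFrom_eq (t u v : W) {S : Finset W} (hS : cs.lengthLE (cs.length v) ⊆ S) :
    o.cdFrom t u v = (if u = v then 1 else 0) + ∑ z ∈ S, if cs.BruhatEdge u z then
      (if o.reflLT t (u⁻¹ * z) then a else b) * o.cdFrom (u⁻¹ * z) z v else 0 := by
  rw [cdFrom, sum_pathFinset _ u v hS]
  congr 1
  refine Finset.sum_congr rfl fun z _ => ?_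
  split_ifs with h1 h2
  all_goals try rfl
  all_goals
    rw [cdFrom, Finset.mul_sum]
    refine Finset.sum_congr rfl fun p hp => ?_
    have hp := (mem_pathFinset.1 hp).2.1
    rcases p with _ | ⟨x, p⟩
    · simp at hp
    obtain rfl : x = z := by simpa using hp
    simp [pathMonomial, h2]

open scoped Classical in
theorem cdIndex_eq_sum_cdFrom (u v : W) {S : Finset W} (hS : cs.lengthLE (cs.length v) ⊆ S) :
    o.cdIndex u v = ∑ z ∈ S, if cs.BruhatEdge u z then o.cdFrom (u⁻¹ * z) z v else 0 := by
  have h1 : completeCDIndex o u v = ∑ p ∈ cs.pathFinset u v, pathMonomial o p := rfl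
  rw [cdIndex, h1, sum_pathFinset _ u v hS]
  have h2 : pathMonomial o [u] = 1 := rfl
  rw [h2, add_sub_cancel_left]
  refine Finset.sum_congr rfl fun z _ => ?_
  simp [cdFrom]

theorem cdFrom_eq_zero {t u v : W} (h : cs.length v < cs.length u) : o.cdFrom t u v = 0 := by
  rw [cdFrom, pathFinset_eq_empty h, Finset.sum_empty]

theorem cdIndex_eq_zero {u v : W} (h : cs.length v ≤ cs.length u) : o.cdIndex u v = 0 := by
  classical
  rw [cdIndex_eq_sum_cdFrom _ _ _ subset_rfl]
  refine Finset.sum_eq_zero fun z _ => ?_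
  split_ifs with hz
  · exact o.cdFrom_eq_zero (h.trans_lt (bruhatEdge_iff.1 hz).2)
  · rfl

theorem cdHat_eq_zero {u v : W} (h : cs.length v < cs.length u) : o.cdHat u v = 0 := by
  rw [cdHat, o.cdIndex_eq_zero h.le, if_neg (by rintro rfl; exact _root_.lt_irrefl _ h)]
  simp

/-- Each letter is b, plus a - b at an ascent. Cutting where b is first chosen leaves an increasing
run from u to x weighted by powers of a - b, followed either by the end of the path or by b and an
arbitrary nonempty path from x to v. -/
theorem cdFrom_eq_sum (t u v : W) :
    o.cdFrom t u v = ∑ x ∈ cs.lengthLE (cs.length v),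
      evalSub (cs.incPoly o.reflLT {t' | o.reflLT t t'} u x) * o.cdHat x v := by
  classical
  induction hn : cs.length v + 1 - cs.length u using Nat.strong_induction_on generalizing u t with
  | _ n ih =>
  subst hn
  set L := cs.lengthLE (cs.length v) with hL
  by_cases hu : cs.length v < cs.length u
  · rw [o.cdFrom_eq_zero hu, Finset.sum_eq_zero]
    intro x hx
    rw [hL, mem_lengthLE] at hx
    rw [incPoly_eq_zero_of_lt (hx.trans_lt hu), map_zero, zero_mul]
  have e1 (x) (hx : x ∈ L) : evalSub (cs.incPoly o.reflLT {t' | o.reflLT t t'} u x) * o.cdHat x v =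
      (if u = x then o.cdHat x v else 0) + (a - b) * ∑ z ∈ L,
        if cs.BruhatEdge u z ∧ o.reflLT t (u⁻¹ * z) then
          evalSub (cs.incPoly o.reflLT {t' | o.reflLT (u⁻¹ * z) t'} z x) * o.cdHat x v else 0 := by
    rw [incPoly_eq (S := L)]
    · rw [map_add, map_mul, evalSub_X, add_mul, mul_assoc, map_sum, Finset.sum_mul]
      congr 1
      · split_ifs <;> simp
      · congr 1
        refine Finset.sum_congr rfl fun z _ => ?_
        rw [bruhatEdge_iff]
        by_cases h1 : o.reflLT t (u⁻¹ * z)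
        · have e : {t' | t' ∈ {t' | o.reflLT t t'} ∧ o.reflLT (u⁻¹ * z) t'} =
              {t' | o.reflLT (u⁻¹ * z) t'} := by
            ext t'
            exact ⟨fun h => h.2, fun h => ⟨o.reflLT_trans h1 h, h⟩⟩
          rw [e]
          have := o.reflLT_right h1
          simp only [Set.mem_ofPred_eq, h1, this, true_and, and_true]
          split_ifs <;> simp
        · simp [h1]
    · intro y hy
      rw [hL, mem_lengthLE] at *
      exact hy.trans hx
  rw [Finset.sum_congr rfl e1, Finset.sum_add_distrib, Finset.sum_ite_eq,
    if_pos (mem_lengthLE.2 (not_lt.1 hu)), ← Finset.mul_sum, Finset.sum_comm, cdHat,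
    o.cdIndex_eq_sum_cdFrom u v (S := L) subset_rfl, o.cdFrom_eq t u v (S := L) subset_rfl,
    add_assoc]
  congr 1
  rw [Finset.mul_sum, Finset.mul_sum, ← Finset.sum_add_distrib]
  refine Finset.sum_congr rfl fun z _ => ?_
  by_cases h1 : cs.BruhatEdge u z
  · have h3 := (bruhatEdge_iff.1 h1).2
    by_cases h2 : o.reflLT t (u⁻¹ * z)
    · simp only [h1, h2, and_self, if_true]
      rw [← ih _ (by omega) (u⁻¹ * z) z rfl, sub_mul]
      abel
    · simp [h1, h2]
  · simp [h1]

/-- The quotient `(R̃_{u,v} - δ_{u,v}) / q`. -/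
def kernelPoly (u v : W) : ℤ[X] := (o.rPoly u v).divX

open scoped Classical in
theorem rPoly_eq_add_mul_sum (u v : W) {S : Finset W} (hS : cs.lengthLE (cs.length v) ⊆ S) :
    o.rPoly u v = (if u = v then 1 else 0) + X * ∑ z ∈ S, if cs.BruhatEdge u z then
      cs.incPoly o.reflLT {t' | o.reflLT (u⁻¹ * z) t'} z v else 0 := by
  rw [rPoly, incPoly_eq hS]
  congr 2
  refine Finset.sum_congr rfl fun z _ => ?_
  refine if_congr bruhatEdge_iff.symm ?_ rfl
  congr 1
  ext t
  exact ⟨fun h => h.2, fun h => ⟨o.reflLT_right h, h⟩⟩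

open scoped Classical in
theorem kernelPoly_eq_sum (u v : W) {S : Finset W} (hS : cs.lengthLE (cs.length v) ⊆ S) :
    o.kernelPoly u v = ∑ z ∈ S, if cs.BruhatEdge u z then
      cs.incPoly o.reflLT {t' | o.reflLT (u⁻¹ * z) t'} z v else 0 := by
  rw [kernelPoly, o.rPoly_eq_add_mul_sum u v hS, divX_add]
  have h1 : divX (if u = v then 1 else 0 : ℤ[X]) = 0 := by split_ifs <;> simp
  rw [h1, zero_add]
  ext n
  simp [coeff_divX]

open scoped Classical in
theorem rPoly_eq_kernelPoly (u v : W) :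
    o.rPoly u v = (if u = v then 1 else 0) + X * o.kernelPoly u v := by
  rw [o.kernelPoly_eq_sum u v subset_rfl, o.rPoly_eq_add_mul_sum u v subset_rfl]

theorem kernelPoly_eq_zero {u v : W} (h : cs.length v ≤ cs.length u) : o.kernelPoly u v = 0 := by
  classical
  rw [kernelPoly, rPoly, incPoly_of_length_le h]
  split_ifs <;> simp

/-- The initial run of `cdFrom_eq_sum` now includes the first edge, which carries no letter; hence
the division of R̃ - δ by q. -/
theorem cdIndex_eq_sum (u v : W) {S : Finset W} (hS : cs.lengthLE (cs.length v) ⊆ S) :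
    o.cdIndex u v = ∑ x ∈ S, evalSub (o.kernelPoly u x) * o.cdHat x v := by
  classical
  have key : o.cdIndex u v =
      ∑ x ∈ cs.lengthLE (cs.length v), evalSub (o.kernelPoly u x) * o.cdHat x v := by
    have e (x) (hx : x ∈ cs.lengthLE (cs.length v)) : evalSub (o.kernelPoly u x) * o.cdHat x v =
        ∑ z ∈ cs.lengthLE (cs.length v), if cs.BruhatEdge u z then
          evalSub (cs.incPoly o.reflLT {t' | o.reflLT (u⁻¹ * z) t'} z x) * o.cdHat x v else 0 := by
      rw [o.kernelPoly_eq_sum u x (S := cs.lengthLE (cs.length v)), map_sum, Finset.sum_mul]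
      · refine Finset.sum_congr rfl fun z _ => ?_
        split_ifs <;> simp
      · intro y hy
        rw [mem_lengthLE] at *
        exact hy.trans hx
    rw [Finset.sum_congr rfl e, Finset.sum_comm, o.cdIndex_eq_sum_cdFrom u v subset_rfl]
    refine Finset.sum_congr rfl fun z _ => ?_
    split_ifs with h
    · exact o.cdFrom_eq_sum _ _ _
    · simp
  rw [key]
  refine Finset.sum_subset hS fun x _ hx => ?_
  rw [mem_lengthLE, not_le] at hx
  rw [o.cdHat_eq_zero hx, mul_zero]

/-- The complete `cd`-index does not depend on the reflection ordering. -/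
theorem cdIndex_eq (hM : M.IsThreeComplete) (o o' : cs.ReflectionOrdering) (u v : W) :
    o.cdIndex u v = o'.cdIndex u v := by
  induction hn : cs.length v - cs.length u using Nat.strong_induction_on generalizing u with
  | _ n ih =>
  subst hn
  rw [o.cdIndex_eq_sum u v subset_rfl, o'.cdIndex_eq_sum u v subset_rfl]
  refine Finset.sum_congr rfl fun x hx => ?_
  rw [mem_lengthLE] at hx
  have h1 : o.kernelPoly u x = o'.kernelPoly u x := by
    rw [kernelPoly, kernelPoly, rPoly_eq hM o o']
  rw [h1]
  by_cases h : cs.length x ≤ cs.length u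
  · rw [o'.kernelPoly_eq_zero h, map_zero, zero_mul, zero_mul]
  · rw [cdHat, cdHat, ih _ (by omega) x rfl]

end ReflectionOrdering

end CoxeterSystem
end

/-! ### Parabolic subgroups and R̃-polynomials below ty and ys. -/

noncomputable section

namespace CoxeterSystem

open CoxeterMatrix Polynomial CompleteCD

variable {B W : Type*} [Group W] {M : CoxeterMatrix B} {cs : CoxeterSystem M W}
  {J : Set B} {s t : B} {x y : W}

/-- A simple reflection changes only its own coordinate. This invariant detects elements outside the
parabolic subgroup and ascents out of it. -/
theorem geomRep_apply_of_mem_parabolic (hx : x ∈ cs.parabolic J) (hs : s ∉ J) (β : B →₀ ℝ) :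
    cs.geomRep x β s = β s := by
  revert β
  refine Subgroup.closure_induction (p := fun x _ => ∀ β : B →₀ ℝ, cs.geomRep x β s = β s)
    ?_ ?_ ?_ ?_ hx
  · rintro _ ⟨i, hi, rfl⟩ β
    exact cs.geomRep_simple_apply_of_ne i s (by rintro rfl; exact hs hi) β
  · intro β; rw [geomRep_one_apply]
  · intro x y _ _ hx hy β
    rw [geomRep_mul_apply, hx, hy]
  · intro x _ hx β
    rw [← hx, geomRep_apply_inv_self]

theorem simple_notMem_parabolic (hs : s ∉ J) : cs.simple s ∉ cs.parabolic J := by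
  intro h
  have := geomRep_apply_of_mem_parabolic h hs (simpleRoot s)
  rw [geomRep_simple_self, Finsupp.neg_apply, simpleRoot_apply_self] at this
  norm_num at this

theorem mul_simple_notMem_parabolic (hs : s ∉ J) (hx : x ∈ cs.parabolic J) :
    x * cs.simple s ∉ cs.parabolic J := by
  rw [Subgroup.mul_mem_cancel_left _ hx]
  exact simple_notMem_parabolic hs

theorem simple_mul_notMem_parabolic (hs : s ∉ J) (hx : x ∈ cs.parabolic J) :
    cs.simple s * x ∉ cs.parabolic J := by
  rw [Subgroup.mul_mem_cancel_right _ hx]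
  exact simple_notMem_parabolic hs

theorem simple_mem_parabolic (hs : s ∈ J) : cs.simple s ∈ cs.parabolic J :=
  Subgroup.subset_closure ⟨s, hs, rfl⟩

variable (hM : M.IsThreeComplete)
include hM

theorem length_lt_mul_simple_of_mem_parabolic (hs : s ∉ J) (hx : x ∈ cs.parabolic J) :
    cs.length x < cs.length (x * cs.simple s) := by
  rw [← cs.geomRep_simpleRoot_nonneg_iff hM]
  refine ((cs.isRoot_simpleRoot s).geomRep x).nonneg_of_apply_pos hM s ?_
  rw [geomRep_apply_of_mem_parabolic hx hs, simpleRoot_apply_self]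
  exact one_pos

theorem length_simple_mul_of_mem_parabolic (hs : s ∉ J) (hx : x ∈ cs.parabolic J) :
    cs.length (cs.simple s * x) = cs.length x + 1 := by
  have h := length_lt_mul_simple_of_mem_parabolic hM hs (inv_mem hx)
  have e : x⁻¹ * cs.simple s = (cs.simple s * x)⁻¹ := by simp
  rw [e, length_inv, length_inv] at h
  have := cs.length_simple_mul x s
  omega

theorem mem_of_length_mul_simple_lt (hx : x ∈ cs.parabolic J)
    (h : cs.length (x * cs.simple s) < cs.length x) : s ∈ J := by
  by_contra hs
  exact absurd h (not_lt.2 (length_lt_mul_simple_of_mem_parabolic hM hs hx).le)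

/-- If x(α_s) has a nonzero coordinate other than s, then s keeps it, so sx(α_s) stays positive.
Otherwise x(α_s) = α_s; for a right descent p of x the vector x(α_p) + α_s is a root because m(p, s)
= 3, it is positive by its s-coordinate, and then x(α_p) ≤ 0 would have to vanish. -/
theorem length_simple_mul_lt_conj (hs : s ∉ J) (hx : x ∈ cs.parabolic J) (hx1 : x ≠ 1) :
    cs.length (cs.simple s * x) < cs.length (cs.simple s * x * cs.simple s) := by
  obtain ⟨p, hp⟩ := cs.exists_rightDescent_of_ne_one hx1
  have hpJ : p ∈ J := mem_of_length_mul_simple_lt hM hx hp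
  have hps : p ≠ s := by rintro rfl; exact hs hpJ
  have hneg := cs.geomRep_simpleRoot_nonpos hM x p hp
  have hpos := (cs.geomRep_simpleRoot_nonneg_iff hM x s).2
    (length_lt_mul_simple_of_mem_parabolic hM hs hx)
  have hroot := (cs.isRoot_simpleRoot s).geomRep x
  rw [← cs.geomRep_simpleRoot_nonneg_iff hM]
  obtain ⟨k, hk, hk0⟩ : ∃ k, s ≠ k ∧ cs.geomRep x (simpleRoot s) k ≠ 0 := by
    by_contra! h0
    have h1 : cs.geomRep x (simpleRoot s) = simpleRoot s := by
      ext k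
      rcases eq_or_ne s k with rfl | hk
      · exact geomRep_apply_of_mem_parabolic hx hs _
      · rw [h0 k hk, simpleRoot_apply_of_ne hk]
    have h2 : cs.IsRoot (cs.geomRep x (simpleRoot p) + simpleRoot s) := by
      have := ((cs.isRoot_simpleRoot s).geomRep (cs.simple p)).geomRep x
      rwa [cs.geomRep_simple_simpleRoot hM hps, map_add, h1] at this
    have h3 : cs.geomRep x (simpleRoot p) s = 0 := by
      rw [geomRep_apply_of_mem_parabolic hx hs, simpleRoot_apply_of_ne hps]
    have h4 := h2.nonneg_of_apply_pos hM s (by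
      rw [Finsupp.add_apply, h3, simpleRoot_apply_self]; norm_num)
    refine ((cs.isRoot_simpleRoot p).geomRep x).ne_zero ?_
    ext k
    rcases eq_or_ne s k with rfl | hk
    · exact h3
    · have h5 := h4 k
      rw [Finsupp.add_apply, simpleRoot_apply_of_ne hk, add_zero] at h5
      exact le_antisymm (hneg k) h5
  rw [geomRep_mul_apply]
  refine (hroot.geomRep _).nonneg_of_apply_pos hM k ?_
  rw [cs.geomRep_simple_apply_of_ne s k hk]
  exact lt_of_le_of_ne (hpos k) hk0.symm

theorem simple_mul_mul_simple_notMem_parabolic (hs : s ∉ J)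
    (h : cs.length (cs.simple t * x) < cs.length (cs.simple t * x * cs.simple s)) :
    cs.simple t * x * cs.simple s ∉ cs.parabolic J := by
  intro h'
  have := length_lt_mul_simple_of_mem_parabolic hM hs h'
  rw [simple_mul_simple_cancel_right] at this
  omega

omit hM in
theorem length_simple_mul_lt_simple_mul_mul_simple (hM : M.IsThreeComplete) {r s : B}
    (hrs : r ≠ s) (hx : x ∈ cs.parabolic {i | i ≠ r ∧ i ≠ s}) :
    cs.length (cs.simple r * x) < cs.length (cs.simple r * x * cs.simple s) := by
  refine length_lt_mul_simple_of_mem_parabolic (J := {i | i ≠ s}) hM (by simp) ?_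
  refine mul_mem (simple_mem_parabolic hrs) ?_
  exact Subgroup.closure_mono (Set.image_mono fun i hi => hi.2) hx

namespace ReflectionOrdering

variable [Finite B] (o : cs.ReflectionOrdering) (u : W)

omit hM in
open scoped Classical in
theorem rPoly_one : o.rPoly u 1 = if u = 1 then 1 else 0 :=
  incPoly_of_length_le (by simp)

/-- Right descents of y belong to J, so the recursion never leaves the parabolic subgroup on the
side of y nor enters it on the side of u. -/
theorem rPoly_eq_zero_of_notMem (hy : y ∈ cs.parabolic J) (hu : u ∉ cs.parabolic J) :
    o.rPoly u y = 0 := by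
  induction hn : cs.length y using Nat.strong_induction_on generalizing y u with
  | _ n ih =>
  subst hn
  rcases eq_or_ne y 1 with rfl | hy1
  · rw [rPoly_one, if_neg (by rintro rfl; exact hu (one_mem _))]
  obtain ⟨i, hi⟩ := cs.exists_rightDescent_of_ne_one hy1
  have hi : cs.length (y * cs.simple i) < cs.length y := hi
  have hiJ := simple_mem_parabolic (cs := cs) (mem_of_length_mul_simple_lt hM hy hi)
  have hy' := mul_mem hy hiJ
  rw [rPoly_recursion hM o i u hi, ih _ hi _ hy' hu rfl,
    ih _ hi _ hy' (by rwa [Subgroup.mul_mem_cancel_right _ hiJ]) rfl]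
  simp

open scoped Classical in
theorem rPoly_mul_simple {g : W} (hg : cs.length g < cs.length (g * cs.simple s)) :
    o.rPoly u (g * cs.simple s) = o.rPoly (u * cs.simple s) g +
      if cs.length u < cs.length (u * cs.simple s) then X * o.rPoly u g else 0 := by
  rw [rPoly_recursion hM o s u (by simpa using hg), simple_mul_simple_cancel_right]

/-- The length condition of the recursion disappears: it holds for u in the parabolic subgroup, and
R̃_{u,y} = 0 for the others. -/
theorem rPoly_mul_simple_of_mem (hs : s ∉ J) (hy : y ∈ cs.parabolic J) :
    o.rPoly u (y * cs.simple s) = o.rPoly (u * cs.simple s) y + X * o.rPoly u y := by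
  rw [o.rPoly_mul_simple hM u (length_lt_mul_simple_of_mem_parabolic hM hs hy)]
  by_cases hu : u ∈ cs.parabolic J
  · rw [if_pos (length_lt_mul_simple_of_mem_parabolic hM hs hu)]
  · rw [o.rPoly_eq_zero_of_notMem hM u hy hu]
    simp

/-- A left-handed recursion, deduced from the right-handed one by peeling right descents off y. The
length conditions at u and at tu agree if tu is in the parabolic subgroup; otherwise the terms with
R̃_{tu,·} vanish. -/
theorem rPoly_simple_mul_of_mem (ht : t ∉ J) (hy : y ∈ cs.parabolic J) :
    o.rPoly u (cs.simple t * y) = o.rPoly (cs.simple t * u) y + X * o.rPoly u y := by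
  induction hn : cs.length y using Nat.strong_induction_on generalizing y u with
  | _ n ih =>
  subst hn
  rcases eq_or_ne y 1 with rfl | hy1
  · have h := o.rPoly_mul_simple_of_mem hM u ht (one_mem (cs.parabolic J))
    rw [one_mul] at h
    rw [mul_one, h, rPoly_one, rPoly_one o (cs.simple t * u)]
    congr 2
    rw [eq_iff_iff, mul_eq_one_iff_eq_inv, mul_eq_one_iff_inv_eq, eq_comm]
  obtain ⟨i, hi⟩ := cs.exists_rightDescent_of_ne_one hy1
  have hi : cs.length (y * cs.simple i) < cs.length y := hi
  have hiJ := simple_mem_parabolic (cs := cs) (mem_of_length_mul_simple_lt hM hy hi)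
  have hy' := mul_mem hy hiJ
  have hti : cs.length (cs.simple t * y * cs.simple i) < cs.length (cs.simple t * y) := by
    rw [mul_assoc, length_simple_mul_of_mem_parabolic hM ht hy,
      length_simple_mul_of_mem_parabolic hM ht hy']
    omega
  rw [rPoly_recursion hM o i u hti, rPoly_recursion hM o i u hi,
    rPoly_recursion hM o i (cs.simple t * u) hi, mul_assoc (cs.simple t) y, ih _ hi _ hy' rfl,
    ih _ hi _ hy' rfl, ← mul_assoc (cs.simple t) u]
  by_cases hu : cs.simple t * u ∈ cs.parabolic J
  · have h1 := length_simple_mul_of_mem_parabolic hM ht hu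
    have h2 := length_simple_mul_of_mem_parabolic hM ht (mul_mem hu hiJ)
    rw [mul_assoc, simple_mul_simple_cancel_left, ← mul_assoc] at h2
    rw [simple_mul_simple_cancel_left] at h1
    rw [h1, h2]
    simp only [add_lt_add_iff_right]
    split_ifs <;> ring
  · rw [o.rPoly_eq_zero_of_notMem hM _ hy' hu]
    split_ifs <;> ring

end ReflectionOrdering

end CoxeterSystem
end

/-! ### Kernels and expansions along the fibres {y, ty, ys, tys}. -/

noncomputable section

theorem Polynomial.divX_X_mul_eq {R : Type*} [Semiring R] (p : Polynomial R) :
    (Polynomial.X * p).divX = p := by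
  ext n
  simp [Polynomial.coeff_divX]

namespace CoxeterSystem

open CoxeterMatrix Polynomial CompleteCD

variable {B W : Type*} [Group W] {M : CoxeterMatrix B} {cs : CoxeterSystem M W}
  {J : Set B} {s t : B} {x y : W}

namespace ReflectionOrdering

variable [Finite B] (o : cs.ReflectionOrdering)

/-- The kernel polynomials between the elements `x, tx, xs, txs` and `y, ty, ys, tys`, for `x, y` in
a parabolic subgroup avoiding `s` and `t`. -/
theorem kernelPoly_fibre (hM : M.IsThreeComplete) (hs : s ∉ J) (ht : t ∉ J)
    (hx : x ∈ cs.parabolic J)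
    (hxt : cs.length (cs.simple t * x) < cs.length (cs.simple t * x * cs.simple s))
    (hy : y ∈ cs.parabolic J)
    (hyt : cs.length (cs.simple t * y) < cs.length (cs.simple t * y * cs.simple s)) :
    (o.kernelPoly x (cs.simple t * y) = o.rPoly x y ∧
      o.kernelPoly x (y * cs.simple s) = o.rPoly x y ∧
      o.kernelPoly x (cs.simple t * y * cs.simple s) = X * o.rPoly x y) ∧
    (o.kernelPoly (cs.simple t * x) y = 0 ∧
      o.kernelPoly (cs.simple t * x) (cs.simple t * y) = o.kernelPoly x y ∧
      o.kernelPoly (cs.simple t * x) (y * cs.simple s) = 0 ∧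
      o.kernelPoly (cs.simple t * x) (cs.simple t * y * cs.simple s) = o.rPoly x y) ∧
    (o.kernelPoly (x * cs.simple s) y = 0 ∧
      o.kernelPoly (x * cs.simple s) (cs.simple t * y) = 0 ∧
      o.kernelPoly (x * cs.simple s) (y * cs.simple s) = o.kernelPoly x y ∧
      o.kernelPoly (x * cs.simple s) (cs.simple t * y * cs.simple s) = o.rPoly x y) ∧
    (o.kernelPoly (cs.simple t * x * cs.simple s) y = 0 ∧
      o.kernelPoly (cs.simple t * x * cs.simple s) (cs.simple t * y) = 0 ∧
      o.kernelPoly (cs.simple t * x * cs.simple s) (y * cs.simple s) = 0 ∧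
      o.kernelPoly (cs.simple t * x * cs.simple s) (cs.simple t * y * cs.simple s) =
        o.kernelPoly x y) := by
  classical
  -- As tx, xs and txs lie outside the parabolic subgroup, their R̃ to y vanishes; everything else
  -- follows by unrolling the recursions.
  have n1 : o.rPoly (cs.simple t * x) y = 0 :=
    o.rPoly_eq_zero_of_notMem hM _ hy (simple_mul_notMem_parabolic ht hx)
  have n2 : o.rPoly (x * cs.simple s) y = 0 :=
    o.rPoly_eq_zero_of_notMem hM _ hy (mul_simple_notMem_parabolic hs hx)
  have n3 : o.rPoly (cs.simple t * x * cs.simple s) y = 0 :=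
    o.rPoly_eq_zero_of_notMem hM _ hy (simple_mul_mul_simple_notMem_parabolic hM hs hxt)
  have n3' : o.rPoly (cs.simple t * (x * cs.simple s)) y = 0 := by rw [← mul_assoc, n3]
  have n2' : o.rPoly (cs.simple t * (cs.simple t * x * cs.simple s)) y = 0 := by
    rw [mul_assoc, simple_mul_simple_cancel_left, n2]
  have hxs := length_lt_mul_simple_of_mem_parabolic hM hs hx
  have L (u) := o.rPoly_simple_mul_of_mem hM u ht hy
  have Rt (u) := o.rPoly_mul_simple_of_mem hM u hs hy
  have LR (u) := o.rPoly_mul_simple hM u hyt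
  simp only [kernelPoly]
  simp only [LR, Rt, L, n1, n2, n3, n3', n2', simple_mul_simple_cancel_right,
    simple_mul_simple_cancel_left, hxs, hxt, not_lt.2 hxs.le, not_lt.2 hxt.le, if_true, if_false,
    zero_add, add_zero, mul_zero, divX_X_mul_eq, divX_zero, and_self]

/-- The degenerate fibre of the identity for t = s. Since txs = 1 is now inside the parabolic
subgroup, R̃_{1,sys} = (1 + q²) R̃_{1,y}, and s reaches both sy and ys. -/
theorem kernelPoly_one_fibre (hM : M.IsThreeComplete) (hs : s ∉ J) (hy : y ∈ cs.parabolic J)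
    (hyt : cs.length (cs.simple s * y) < cs.length (cs.simple s * y * cs.simple s)) :
    (o.kernelPoly 1 (cs.simple s * y) = o.rPoly 1 y ∧
      o.kernelPoly 1 (y * cs.simple s) = o.rPoly 1 y ∧
      o.kernelPoly 1 (cs.simple s * y * cs.simple s) = o.kernelPoly 1 y + X * o.rPoly 1 y) ∧
    (o.kernelPoly (cs.simple s) y = 0 ∧
      o.kernelPoly (cs.simple s) (cs.simple s * y) = o.kernelPoly 1 y ∧
      o.kernelPoly (cs.simple s) (y * cs.simple s) = o.kernelPoly 1 y ∧
      o.kernelPoly (cs.simple s) (cs.simple s * y * cs.simple s) = o.rPoly 1 y) := by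
  classical
  have n1 : o.rPoly (cs.simple s) y = 0 :=
    o.rPoly_eq_zero_of_notMem hM _ hy (simple_notMem_parabolic hs)
  have L (u) := o.rPoly_simple_mul_of_mem hM u hs hy
  have Rt (u) := o.rPoly_mul_simple_of_mem hM u hs hy
  have LR (u) := o.rPoly_mul_simple hM u hyt
  simp only [kernelPoly]
  simp [LR, Rt, L, n1, divX_add, divX_X_mul_eq]

/-- By iterating `cdIndex_eq_sum`, a nonzero value at u requires a chain of nonzero R̃ from u up to
w. -/
theorem cdHat_support {D : Set W} {w : W} (hD : ∀ u z, z ∈ D → o.rPoly u z ≠ 0 → u ∈ D)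
    (hw : w ∈ D) {u : W} (hu : o.cdHat u w ≠ 0) : u ∈ D := by
  classical
  induction hn : cs.length w - cs.length u using Nat.strong_induction_on generalizing u with
  | _ n ih =>
  subst hn
  by_cases huw : u = w
  · rwa [huw]
  rw [cdHat, if_neg huw, zero_add] at hu
  have h1 := right_ne_zero_of_mul hu
  rw [o.cdIndex_eq_sum u w subset_rfl] at h1
  obtain ⟨z, hz, hz0⟩ := Finset.exists_ne_zero_of_sum_ne_zero h1
  rw [mem_lengthLE] at hz
  have h2 : o.kernelPoly u z ≠ 0 := by
    intro h; rw [h] at hz0; simp at hz0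
  have h3 : cs.length u < cs.length z := by
    by_contra h; exact h2 (o.kernelPoly_eq_zero (not_lt.1 h))
  refine hD u z (ih _ (by omega) (right_ne_zero_of_mul hz0) rfl) fun h => h2 ?_
  rw [kernelPoly, h, divX_zero]

theorem length_le_of_cdHat_ne_zero {u w : W} (h : o.cdHat u w ≠ 0) :
    cs.length u ≤ cs.length w := by
  by_contra h'
  exact h (o.cdHat_eq_zero (not_le.1 h'))

theorem cdIndex_eq_sum_of_support (u w : W) (E : Finset W) (hE : ∀ z, o.cdHat z w ≠ 0 → z ∈ E) :
    o.cdIndex u w = ∑ z ∈ E, evalSub (o.kernelPoly u z) * o.cdHat z w := by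
  classical
  rw [o.cdIndex_eq_sum u w (S := cs.lengthLE (cs.length w) ∪ E) Finset.subset_union_left]
  refine (Finset.sum_subset Finset.subset_union_right fun z _ hz => ?_).symm
  rw [not_imp_comm.1 (hE z) hz, mul_zero]

/-- The expansion of the complete `cd`-index along the cosets `{y, ty, ys, tys}`. -/
theorem cdIndex_eq_sum_fibre (hM : M.IsThreeComplete) (hs : s ∉ J) (ht : t ∉ J) (u w : W)
    (E F : Finset W) (hF : ∀ y ∈ F, y ∈ cs.parabolic J ∧
      cs.length (cs.simple t * y) < cs.length (cs.simple t * y * cs.simple s))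
    (hcover : ∀ z, o.cdHat z w ≠ 0 → z ∈ E ∨ ∃ y ∈ F, z = y ∨ z = cs.simple t * y ∨
      z = y * cs.simple s ∨ z = cs.simple t * y * cs.simple s)
    (hdisj : ∀ z ∈ E, ∀ y ∈ F, z ≠ y ∧ z ≠ cs.simple t * y ∧
      z ≠ y * cs.simple s ∧ z ≠ cs.simple t * y * cs.simple s) :
    o.cdIndex u w = ∑ z ∈ E, evalSub (o.kernelPoly u z) * o.cdHat z w +
      ∑ y ∈ F, (evalSub (o.kernelPoly u y) * o.cdHat y w +
        evalSub (o.kernelPoly u (cs.simple t * y)) * o.cdHat (cs.simple t * y) w +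
        evalSub (o.kernelPoly u (y * cs.simple s)) * o.cdHat (y * cs.simple s) w +
        evalSub (o.kernelPoly u (cs.simple t * y * cs.simple s)) *
          o.cdHat (cs.simple t * y * cs.simple s) w) := by
  classical
  -- The four translates of `F` are pairwise disjoint because ty, ys and tys all lie outside the
  -- parabolic subgroup.
  have n1 {y} (hy : y ∈ F) := simple_mul_notMem_parabolic (cs := cs) ht (hF y hy).1
  have n2 {y} (hy : y ∈ F) := mul_simple_notMem_parabolic (cs := cs) hs (hF y hy).1
  have n3 {y} (hy : y ∈ F) := simple_mul_mul_simple_notMem_parabolic hM hs (hF y hy).2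
  rw [o.cdIndex_eq_sum_of_support u w (E ∪ (((F ∪ F.image (cs.simple t * ·)) ∪
    F.image (· * cs.simple s)) ∪ F.image (cs.simple t * · * cs.simple s))),
    Finset.sum_union, Finset.sum_union, Finset.sum_union, Finset.sum_union,
    Finset.sum_image (fun x _ y _ h => by simpa using h),
    Finset.sum_image (fun x _ y _ h => by simpa using h),
    Finset.sum_image (fun x _ y _ h => by simpa using h),
    Finset.sum_add_distrib, Finset.sum_add_distrib, Finset.sum_add_distrib]
  · rw [Finset.disjoint_left]
    intro z hz hz'
    obtain ⟨y, hy, rfl⟩ := Finset.mem_image.1 hz'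
    exact n1 hy (hF _ hz).1
  · rw [Finset.disjoint_left]
    intro z hz hz'
    obtain ⟨y, hy, rfl⟩ := Finset.mem_image.1 hz'
    rcases Finset.mem_union.1 hz with hz | hz
    · exact n2 hy (hF _ hz).1
    · obtain ⟨x, hx, h⟩ := Finset.mem_image.1 hz
      have h : cs.simple t * x = y * cs.simple s := h
      refine n3 hy ?_
      rw [mul_assoc, ← h, simple_mul_simple_cancel_left]
      exact (hF x hx).1
  · rw [Finset.disjoint_left]
    intro z hz hz'
    obtain ⟨y, hy, rfl⟩ := Finset.mem_image.1 hz'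
    rcases Finset.mem_union.1 hz with hz | hz
    · rcases Finset.mem_union.1 hz with hz | hz
      · exact n3 hy (hF _ hz).1
      · obtain ⟨x, hx, h⟩ := Finset.mem_image.1 hz
        have h : cs.simple t * x = cs.simple t * y * cs.simple s := h
        rw [mul_assoc, mul_right_inj] at h
        exact n2 hy (h ▸ (hF x hx).1)
    · obtain ⟨x, hx, h⟩ := Finset.mem_image.1 hz
      have h : x * cs.simple s = cs.simple t * y * cs.simple s := h
      rw [mul_left_inj] at h
      exact n1 hy (h ▸ (hF x hx).1)
  · rw [Finset.disjoint_left]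
    intro z hz hz'
    simp only [Finset.mem_union, Finset.mem_image] at hz'
    rcases hz' with ((hz' | ⟨y, hy, rfl⟩) | ⟨y, hy, rfl⟩) | ⟨y, hy, rfl⟩
    · exact (hdisj z hz z hz').1 rfl
    · exact (hdisj _ hz y hy).2.1 rfl
    · exact (hdisj _ hz y hy).2.2.1 rfl
    · exact (hdisj _ hz y hy).2.2.2 rfl
  · intro z hz
    simp only [Finset.mem_union, Finset.mem_image]
    rcases hcover z hz with h | ⟨y, hy, rfl | rfl | rfl | rfl⟩
    · exact Or.inl h
    · exact Or.inr (Or.inl (Or.inl (Or.inl hy)))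
    · exact Or.inr (Or.inl (Or.inl (Or.inr ⟨y, hy, rfl⟩)))
    · exact Or.inr (Or.inl (Or.inr ⟨y, hy, rfl⟩))
    · exact Or.inr (Or.inr ⟨y, hy, rfl⟩)

/-- Paths ending in `tvs` only meet elements of the cosets `{y, ty, ys, tys}`. -/
theorem exists_fibre_of_cdHat_ne_zero (hM : M.IsThreeComplete) (hs : s ∉ J) (ht : t ∉ J)
    (hgood : ∀ y ∈ cs.parabolic J, y ≠ 1 →
      cs.length (cs.simple t * y) < cs.length (cs.simple t * y * cs.simple s))
    (h1 : cs.simple t = cs.simple s ∨ cs.length (cs.simple t) <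
      cs.length (cs.simple t * cs.simple s)) {v : W} (hv : v ∈ cs.parabolic J)
    {z : W} (hz : o.cdHat z (cs.simple t * v * cs.simple s) ≠ 0) :
    ∃ y ∈ cs.parabolic J, cs.length y ≤ cs.length v + 4 ∧ (z = y ∨ z = cs.simple t * y ∨
      z = y * cs.simple s ∨ z = cs.simple t * y * cs.simple s) := by
  classical
  set D : Set W := {z | z ∈ cs.parabolic J ∨ cs.simple t * z ∈ cs.parabolic J ∨
    z * cs.simple s ∈ cs.parabolic J ∨ cs.simple t * (z * cs.simple s) ∈ cs.parabolic J} with hD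
  have key : z ∈ D := by
    refine o.cdHat_support (D := D) (w := cs.simple t * v * cs.simple s) ?_ ?_ hz
    -- If u is not in `D`, then u, tu, us and tus all avoid the parabolic subgroup, and the
    -- recursions give R̃_{u,z} = 0 for every z in `D`.
    · intro u z hzD hR
      by_contra hu
      simp only [hD, Set.mem_ofPred_eq, not_or] at hu
      obtain ⟨u1, u2, u3, u4⟩ := hu
      have P1 {y} (hy : y ∈ cs.parabolic J) : o.rPoly u y = 0 :=
        o.rPoly_eq_zero_of_notMem hM u hy u1
      have P2 {y} (hy : y ∈ cs.parabolic J) : o.rPoly u (cs.simple t * y) = 0 := by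
        rw [o.rPoly_simple_mul_of_mem hM u ht hy, P1 hy, o.rPoly_eq_zero_of_notMem hM _ hy u2]
        simp
      have P3 {y} (hy : y ∈ cs.parabolic J) : o.rPoly u (y * cs.simple s) = 0 := by
        rw [o.rPoly_mul_simple_of_mem hM u hs hy, P1 hy, o.rPoly_eq_zero_of_notMem hM _ hy u3]
        simp
      rcases hzD with h | h | h | h
      · exact hR (P1 h)
      · refine hR ?_
        rw [← cs.simple_mul_simple_cancel_left (w := z) t]
        exact P2 h
      · refine hR ?_
        rw [← cs.simple_mul_simple_cancel_right (w := z) s]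
        exact P3 h
      · obtain ⟨y, rfl⟩ : ∃ y, z = cs.simple t * y * cs.simple s :=
          ⟨cs.simple t * (z * cs.simple s), by simp⟩
        simp only [simple_mul_simple_cancel_right, simple_mul_simple_cancel_left] at h
        by_cases hlt : cs.length (cs.simple t * y) < cs.length (cs.simple t * y * cs.simple s)
        · refine hR ?_
          rw [o.rPoly_mul_simple hM u hlt, o.rPoly_simple_mul_of_mem hM _ ht h, P2 h,
            o.rPoly_eq_zero_of_notMem hM _ h u3, o.rPoly_eq_zero_of_notMem hM _ h u4]
          simp
        -- Only y = 1 can fail the length condition; then t = s and the element is 1 itself.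
        · have hy1 : y = 1 := by
            by_contra hy1
            exact hlt (hgood y h hy1)
          subst hy1
          rw [mul_one] at hlt hR
          rcases h1 with h1 | h1
          · rw [h1, simple_mul_simple_self] at hR
            exact hR (P1 (one_mem _))
          · exact hlt h1
    · simp [hD, hv]
  -- Hence ℓ(z) ≤ ℓ(tvs) ≤ ℓ(v) + 2, and y differs from z by at most two simple factors: this is the
  -- bound ℓ(v) + 4.
  have hl := o.length_le_of_cdHat_ne_zero hz
  have hl2 := cs.length_mul_simple (cs.simple t * v) s
  have hl3 := cs.length_simple_mul v t
  rcases key with h | h | h | h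
  · exact ⟨z, h, by omega, Or.inl rfl⟩
  · have := cs.length_simple_mul z t
    exact ⟨_, h, by omega, Or.inr (Or.inl (by simp))⟩
  · have := cs.length_mul_simple z s
    exact ⟨_, h, by omega, Or.inr (Or.inr (Or.inl (by simp)))⟩
  · have h4 := cs.length_mul_simple z s
    have h5 := cs.length_simple_mul (z * cs.simple s) t
    exact ⟨_, h, by omega, Or.inr (Or.inr (Or.inr (by simp)))⟩

/-- A linear recursion along the kernel polynomials has at most one solution. -/
theorem eq_of_kernel_recursion {F : Finset W} {f g c : W → ABPoly}
    (hf : ∀ x ∈ F, f x = c x + b * ∑ y ∈ F, evalSub (o.kernelPoly x y) * f y)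
    (hg : ∀ x ∈ F, g x = c x + b * ∑ y ∈ F, evalSub (o.kernelPoly x y) * g y) :
    ∀ x ∈ F, f x = g x := by
  intro x hx
  -- The kernel from x to y vanishes unless y is longer than x, so the recursion is solved downwards
  -- from the longest elements.
  induction hn : F.sup cs.length - cs.length x using Nat.strong_induction_on generalizing x with
  | _ n ih =>
  subst hn
  rw [hf x hx, hg x hx]
  congr 2
  refine Finset.sum_congr rfl fun y hy => ?_
  by_cases hxy : cs.length y ≤ cs.length x
  · rw [o.kernelPoly_eq_zero hxy, map_zero, zero_mul, zero_mul]
  · have : cs.length y ≤ F.sup cs.length := Finset.le_sup hy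
    rw [ih _ (by omega) y hy rfl]

end ReflectionOrdering

end CoxeterSystem
end

/-! ### Comparison of the two conjugates and the final computation. -/

noncomputable section

namespace CoxeterSystem

open CoxeterMatrix Polynomial CompleteCD

variable {B W : Type*} [Group W] {M : CoxeterMatrix B} {cs : CoxeterSystem M W}
  {J : Set B} {s t : B}

namespace ReflectionOrdering

variable [Finite B] (o : cs.ReflectionOrdering)

theorem cdHat_of_ne {u v : W} (h : u ≠ v) : o.cdHat u v = b * o.cdIndex u v := by
  rw [cdHat, if_neg h, zero_add]

open scoped Classical in
-- Here `c` is meant for the fibre of the identity, which is not reached from the fibres over `F`.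
-- The resulting system is triangular, from txs down to x, and its coefficients do not involve t.
theorem cdHat_fibre_recursion (hM : M.IsThreeComplete) (hs : s ∉ J) (ht : t ∉ J) {v : W}
    {F : Finset W} (hF : ∀ y ∈ F, y ∈ cs.parabolic J ∧
      cs.length (cs.simple t * y) < cs.length (cs.simple t * y * cs.simple s)) (hv : v ∈ F)
    {w : W} (hw : w = cs.simple t * v * cs.simple s) {c : W → ABPoly}
    (hsum : ∀ u, o.cdIndex u w = c u +
      ∑ y ∈ F, (evalSub (o.kernelPoly u y) * o.cdHat y w +
        evalSub (o.kernelPoly u (cs.simple t * y)) * o.cdHat (cs.simple t * y) w +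
        evalSub (o.kernelPoly u (y * cs.simple s)) * o.cdHat (y * cs.simple s) w +
        evalSub (o.kernelPoly u (cs.simple t * y * cs.simple s)) *
          o.cdHat (cs.simple t * y * cs.simple s) w))
    {x : W} (hx : x ∈ F) (hc : c x = 0 ∧ c (cs.simple t * x) = 0 ∧ c (x * cs.simple s) = 0 ∧
      c (cs.simple t * x * cs.simple s) = 0) :
    o.cdHat (cs.simple t * x * cs.simple s) w = (if x = v then 1 else 0) +
      b * ∑ y ∈ F, evalSub (o.kernelPoly x y) * o.cdHat (cs.simple t * y * cs.simple s) w ∧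
    o.cdHat (cs.simple t * x) w =
      b * (∑ y ∈ F, evalSub (o.rPoly x y) * o.cdHat (cs.simple t * y * cs.simple s) w) +
      b * ∑ y ∈ F, evalSub (o.kernelPoly x y) * o.cdHat (cs.simple t * y) w ∧
    o.cdHat (x * cs.simple s) w =
      b * (∑ y ∈ F, evalSub (o.rPoly x y) * o.cdHat (cs.simple t * y * cs.simple s) w) +
      b * ∑ y ∈ F, evalSub (o.kernelPoly x y) * o.cdHat (y * cs.simple s) w ∧
    o.cdHat x w =
      b * (∑ y ∈ F, (evalSub (o.rPoly x y) * o.cdHat (cs.simple t * y) w +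
        evalSub (o.rPoly x y) * o.cdHat (y * cs.simple s) w +
        evalSub (X * o.rPoly x y) * o.cdHat (cs.simple t * y * cs.simple s) w)) +
      b * ∑ y ∈ F, evalSub (o.kernelPoly x y) * o.cdHat y w := by
  have K {y} (hy : y ∈ F) := o.kernelPoly_fibre hM hs ht (hF x hx).1 (hF x hx).2
    (hF y hy).1 (hF y hy).2
  have ne1 : x ≠ w := by
    rintro rfl
    exact simple_mul_mul_simple_notMem_parabolic hM hs (hF v hv).2 (hw ▸ (hF _ hx).1)
  have ne2 : cs.simple t * x ≠ w := by
    intro h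
    rw [hw, mul_assoc, mul_right_inj] at h
    exact mul_simple_notMem_parabolic hs (hF v hv).1 (h ▸ (hF x hx).1)
  have ne3 : x * cs.simple s ≠ w := by
    intro h
    rw [hw, mul_left_inj] at h
    exact simple_mul_notMem_parabolic ht (hF v hv).1 (h ▸ (hF x hx).1)
  obtain ⟨c1, c2, c3, c4⟩ := hc
  refine ⟨?_, ?_, ?_, ?_⟩
  · rw [cdHat, hsum, c4, zero_add]
    congr 1
    · simp [hw]
    · congr 1
      refine Finset.sum_congr rfl fun y hy => ?_
      obtain ⟨-, -, -, k1, k2, k3, k4⟩ := K hy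
      simp [k1, k2, k3, k4]
  · rw [o.cdHat_of_ne ne2, hsum, c2, zero_add, ← mul_add, ← Finset.sum_add_distrib]
    congr 1
    refine Finset.sum_congr rfl fun y hy => ?_
    obtain ⟨-, ⟨k1, k2, k3, k4⟩, -⟩ := K hy
    simp [k1, k2, k3, k4, add_comm]
  · rw [o.cdHat_of_ne ne3, hsum, c3, zero_add, ← mul_add, ← Finset.sum_add_distrib]
    congr 1
    refine Finset.sum_congr rfl fun y hy => ?_
    obtain ⟨-, -, ⟨k1, k2, k3, k4⟩, -⟩ := K hy
    simp [k1, k2, k3, k4, add_comm]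
  · rw [o.cdHat_of_ne ne1, hsum, c1, zero_add, ← mul_add, ← Finset.sum_add_distrib]
    congr 1
    refine Finset.sum_congr rfl fun y hy => ?_
    obtain ⟨⟨k1, k2, k3⟩, -⟩ := K hy
    rw [k1, k2, k3]
    abel

/-- The identity may be left out because every kernel ending at it is zero; so the same `F` serves
for v and for both conjugates. -/
theorem cdIndex_eq_sum_parabolic (hM : M.IsThreeComplete) {v : W} (hv : v ∈ cs.parabolic J)
    {F : Finset W} (hF : ∀ y ∈ cs.parabolic J, cs.length y ≤ cs.length v → y ≠ 1 → y ∈ F)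
    (hF1 : 1 ∉ F) (u : W) :
    o.cdIndex u v = ∑ y ∈ F, evalSub (o.kernelPoly u y) * o.cdHat y v := by
  classical
  rw [o.cdIndex_eq_sum_of_support u v (insert 1 F), Finset.sum_insert hF1,
    o.kernelPoly_eq_zero (by simp), map_zero, zero_mul, zero_add]
  intro z hz
  have h1 : z ∈ cs.parabolic J := o.cdHat_support (D := cs.parabolic J)
    (fun u z hz h => by_contra fun hu => h (o.rPoly_eq_zero_of_notMem hM u hz hu)) hv hz
  rcases eq_or_ne z 1 with rfl | hz1
  · exact Finset.mem_insert_self _ _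
  · exact Finset.mem_insert_of_mem (hF z h1 (o.length_le_of_cdHat_ne_zero hz) hz1)

theorem kernelPoly_simple_of_ne_one (hM : M.IsThreeComplete) (s : B) {u : W} (hu : u ≠ 1) :
    o.kernelPoly u (cs.simple s) = 0 := by
  classical
  have h := o.rPoly_mul_simple_of_mem hM u (s := s) (J := ∅) (by simp) (one_mem _)
  rw [one_mul, rPoly_one, rPoly_one, if_neg hu, mul_zero, add_zero] at h
  rw [kernelPoly, h]
  split_ifs <;> simp

theorem kernelPoly_one_simple (hM : M.IsThreeComplete) (s : B) :
    o.kernelPoly 1 (cs.simple s) = 1 := by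
  classical
  have h := o.rPoly_mul_simple_of_mem hM 1 (s := s) (J := ∅) (by simp) (one_mem _)
  have hs : cs.simple s ≠ 1 := by
    intro h
    have := cs.length_simple s
    rw [h, length_one] at this
    exact zero_ne_one this
  rw [one_mul, rPoly_one, rPoly_one, if_neg hs, if_pos rfl, zero_add] at h
  rw [kernelPoly, h, divX_X_mul_eq]

theorem cdIndex_conj_add (hM : M.IsThreeComplete) {r s : B} (hrs : r ≠ s) {v : W}
    (hv : v ∈ cs.parabolic {i | i ≠ r ∧ i ≠ s}) (hv1 : v ≠ 1) :
    o.cdIndex 1 (cs.simple s * v * cs.simple s) + d * o.cdIndex 1 v =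
      o.cdIndex 1 (cs.simple r * v * cs.simple s) + o.cdIndex 1 v := by
  classical
  set J : Set B := {i | i ≠ r ∧ i ≠ s} with hJ
  have hr : r ∉ J := by simp [hJ]
  have hs : s ∉ J := by simp [hJ]
  -- The bound is the one in `exists_fibre_of_cdHat_ne_zero`. The identity is set apart because only
  -- its fibre distinguishes r from s.
  set F : Finset W := (cs.lengthLE (cs.length v + 4)).filter
    fun y => y ∈ cs.parabolic J ∧ y ≠ 1 with hF
  have memF {y : W} : y ∈ F ↔ cs.length y ≤ cs.length v + 4 ∧ y ∈ cs.parabolic J ∧ y ≠ 1 := by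
    simp [hF, mem_lengthLE]
  have hvF : v ∈ F := memF.2 ⟨by omega, hv, hv1⟩
  have h1F : (1 : W) ∉ F := fun h => (memF.1 h).2.2 rfl
  have goodr {y : W} (hy : y ∈ cs.parabolic J) :=
    length_simple_mul_lt_simple_mul_mul_simple hM hrs hy
  have goods {y : W} (hy : y ∈ cs.parabolic J) (hy1 : y ≠ 1) :=
    length_simple_mul_lt_conj hM hs hy hy1
  have hFr (y) (hy : y ∈ F) : y ∈ cs.parabolic J ∧ cs.length (cs.simple r * y) <
      cs.length (cs.simple r * y * cs.simple s) := ⟨(memF.1 hy).2.1, goodr (memF.1 hy).2.1⟩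
  have hFs (y) (hy : y ∈ F) : y ∈ cs.parabolic J ∧ cs.length (cs.simple s * y) <
      cs.length (cs.simple s * y * cs.simple s) :=
    ⟨(memF.1 hy).2.1, goods (memF.1 hy).2.1 (memF.1 hy).2.2⟩
  set wr := cs.simple r * v * cs.simple s with hwr
  set ws := cs.simple s * v * cs.simple s with hws
  set cr : W → ABPoly := fun u => evalSub (o.kernelPoly u 1) * o.cdHat 1 wr +
        evalSub (o.kernelPoly u (cs.simple r)) * o.cdHat (cs.simple r) wr +
        evalSub (o.kernelPoly u (cs.simple s)) * o.cdHat (cs.simple s) wr +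
        evalSub (o.kernelPoly u (cs.simple r * cs.simple s)) *
          o.cdHat (cs.simple r * cs.simple s) wr with hcr
  set ds : W → ABPoly := fun u => evalSub (o.kernelPoly u 1) * o.cdHat 1 ws +
        evalSub (o.kernelPoly u (cs.simple s)) * o.cdHat (cs.simple s) ws with hds
  have s_mem := simple_notMem_parabolic (cs := cs) hs
  have r_mem := simple_notMem_parabolic (cs := cs) hr
  have one_ne_s : (1 : W) ≠ cs.simple s := fun h => s_mem (h ▸ one_mem _)
  have sumr (u) : o.cdIndex u wr = cr u +
      ∑ y ∈ F, (evalSub (o.kernelPoly u y) * o.cdHat y wr +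
        evalSub (o.kernelPoly u (cs.simple r * y)) * o.cdHat (cs.simple r * y) wr +
        evalSub (o.kernelPoly u (y * cs.simple s)) * o.cdHat (y * cs.simple s) wr +
        evalSub (o.kernelPoly u (cs.simple r * y * cs.simple s)) *
          o.cdHat (cs.simple r * y * cs.simple s) wr) := by
    -- For r the fibre {1, r, s, rs} of the identity is regular.
    rw [o.cdIndex_eq_sum_fibre hM hs hr u wr ∅ (insert 1 F), Finset.sum_empty, zero_add,
      Finset.sum_insert h1F, mul_one, one_mul]
    · intro y hy
      rcases Finset.mem_insert.1 hy with rfl | hy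
      · exact ⟨one_mem _, goodr (one_mem _)⟩
      · exact hFr y hy
    · intro z hz
      obtain ⟨y, hy, hl, h⟩ := o.exists_fibre_of_cdHat_ne_zero hM hs hr (fun y hy _ => goodr hy)
        (Or.inr (by simpa using goodr (one_mem _))) hv hz
      refine Or.inr ⟨y, ?_, h⟩
      rcases eq_or_ne y 1 with rfl | hy1
      · exact Finset.mem_insert_self _ _
      · exact Finset.mem_insert_of_mem (memF.2 ⟨hl, hy, hy1⟩)
    · simp
  have sums (u) : o.cdIndex u ws = ds u +
      ∑ y ∈ F, (evalSub (o.kernelPoly u y) * o.cdHat y ws +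
        evalSub (o.kernelPoly u (cs.simple s * y)) * o.cdHat (cs.simple s * y) ws +
        evalSub (o.kernelPoly u (y * cs.simple s)) * o.cdHat (y * cs.simple s) ws +
        evalSub (o.kernelPoly u (cs.simple s * y * cs.simple s)) *
          o.cdHat (cs.simple s * y * cs.simple s) ws) := by
    -- For s the fibre of the identity collapses to {1, s}.
    rw [o.cdIndex_eq_sum_fibre hM hs hs u ws {1, cs.simple s} F hFs, Finset.sum_pair one_ne_s]
    · intro z hz
      obtain ⟨y, hy, hl, h⟩ := o.exists_fibre_of_cdHat_ne_zero hM hs hs (fun y hy => goods hy)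
        (Or.inl rfl) hv hz
      rcases eq_or_ne y 1 with rfl | hy1
      · left
        simp only [mul_one, one_mul, simple_mul_simple_self] at h
        rw [Finset.mem_insert, Finset.mem_singleton]
        tauto
      · exact Or.inr ⟨y, memF.2 ⟨hl, hy, hy1⟩, h⟩
    · intro z hz y hy
      have hyJ := (memF.1 hy).2.1
      have hy1 := (memF.1 hy).2.2
      have m1 := simple_mul_notMem_parabolic hs hyJ
      have m2 := mul_simple_notMem_parabolic hs hyJ
      have m3 := simple_mul_mul_simple_notMem_parabolic hM hs (hFs y hy).2
      rcases Finset.mem_insert.1 hz with rfl | hz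
      · exact ⟨hy1.symm, fun h => m1 (h ▸ one_mem _), fun h => m2 (h ▸ one_mem _),
          fun h => m3 (h ▸ one_mem _)⟩
      · rw [Finset.mem_singleton] at hz
        subst hz
        refine ⟨fun h => s_mem (h ▸ hyJ), fun h => hy1 (by simpa using h),
          fun h => hy1 (by simpa using h), fun h => ?_⟩
        rw [mul_assoc, left_eq_mul] at h
        exact m2 (h ▸ one_mem _)
  -- The kernel between an element of `F` and the identity vanishes.
  have K1 {x} : o.kernelPoly x 1 = 0 := o.kernelPoly_eq_zero (by simp)
  have R1 {x} (hx : x ∈ F) : o.rPoly x 1 = 0 := by rw [rPoly_one, if_neg (memF.1 hx).2.2]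
  have hcr0 {x} (hx : x ∈ F) : cr x = 0 ∧ cr (cs.simple r * x) = 0 ∧ cr (x * cs.simple s) = 0 ∧
      cr (cs.simple r * x * cs.simple s) = 0 := by
    have := o.kernelPoly_fibre hM hs hr (hFr x hx).1 (hFr x hx).2 (one_mem _) (goodr (one_mem _))
    simp only [mul_one, one_mul, R1 hx, K1, mul_zero] at this
    simp [hcr, this, K1]
  have hds0 {x} (hx : x ∈ F) : ds x = 0 ∧ ds (cs.simple s * x) = 0 ∧ ds (x * cs.simple s) = 0 ∧
      ds (cs.simple s * x * cs.simple s) = 0 := by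
    have hxJ := (memF.1 hx).2.1
    have m1 := simple_mul_notMem_parabolic hs hxJ
    have m2 := mul_simple_notMem_parabolic hs hxJ
    have m3 := simple_mul_mul_simple_notMem_parabolic hM hs (hFs x hx).2
    simp only [hds, K1, map_zero, zero_mul, zero_add]
    have ne {u : W} (hu : u ∉ cs.parabolic J) : u ≠ 1 := by rintro rfl; exact hu (one_mem _)
    rw [o.kernelPoly_simple_of_ne_one hM s (memF.1 hx).2.2,
      o.kernelPoly_simple_of_ne_one hM s (ne m1), o.kernelPoly_simple_of_ne_one hM s (ne m2),
      o.kernelPoly_simple_of_ne_one hM s (ne m3)]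
    simp
  have recr {x} (hx : x ∈ F) := o.cdHat_fibre_recursion hM hs hr hFr hvF hwr sumr hx (hcr0 hx)
  have recs {x} (hx : x ∈ F) := o.cdHat_fibre_recursion hM hs hs hFs hvF hws sums hx (hds0 hx)
  have sumv (u) : o.cdIndex u v = ∑ y ∈ F, evalSub (o.kernelPoly u y) * o.cdHat y v :=
    o.cdIndex_eq_sum_parabolic hM hv (fun y hy hl hy1 => memF.2 ⟨by omega, hy, hy1⟩) h1F u
  have recv (x) : o.cdHat x v = (if x = v then 1 else 0) +
      b * ∑ y ∈ F, evalSub (o.kernelPoly x y) * o.cdHat y v := by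
    rw [cdHat, sumv]
  -- Compare the complete `cd`-indices on the cosets of the elements of `F`.
  have r0 : ∀ x ∈ F, o.cdHat (cs.simple r * x * cs.simple s) wr = o.cdHat x v :=
    o.eq_of_kernel_recursion (f := fun x => o.cdHat (cs.simple r * x * cs.simple s) wr)
      (fun x hx => (recr hx).1) fun x _ => recv x
  have s0 : ∀ x ∈ F, o.cdHat (cs.simple s * x * cs.simple s) ws = o.cdHat x v :=
    o.eq_of_kernel_recursion (f := fun x => o.cdHat (cs.simple s * x * cs.simple s) ws)
      (fun x hx => (recs hx).1) fun x _ => recv x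
  -- The values at rx and xs below rvs, and at sx and xs below svs, all solve one recursion with
  -- inhomogeneous term `c1`; `g` is their common value.
  set g := fun x => o.cdHat (cs.simple r * x) wr with hg
  set c1 := fun x => b * ∑ y ∈ F, evalSub (o.rPoly x y) * o.cdHat y v with hc1
  have sum0 {t : B} {w : W} (h0 : ∀ x ∈ F, o.cdHat (cs.simple t * x * cs.simple s) w =
      o.cdHat x v) (f : W → ABPoly) :
      ∑ y ∈ F, f y * o.cdHat (cs.simple t * y * cs.simple s) w =
        ∑ y ∈ F, f y * o.cdHat y v :=
    Finset.sum_congr rfl fun y hy => by rw [h0 y hy]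
  have gr : ∀ x ∈ F, g x = c1 x + b * ∑ y ∈ F, evalSub (o.kernelPoly x y) * g y := by
    intro x hx
    have h := (recr hx).2.1
    rw [sum0 r0] at h
    exact h
  have r1 : ∀ x ∈ F, o.cdHat (x * cs.simple s) wr = g x := by
    refine o.eq_of_kernel_recursion (f := fun x => o.cdHat (x * cs.simple s) wr) (c := c1)
      (fun x hx => ?_) gr
    have h := (recr hx).2.2.1
    rw [sum0 r0] at h
    exact h
  have s1 : ∀ x ∈ F, o.cdHat (cs.simple s * x) ws = g x := by
    refine o.eq_of_kernel_recursion (f := fun x => o.cdHat (cs.simple s * x) ws) (c := c1)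
      (fun x hx => ?_) gr
    have h := (recs hx).2.1
    rw [sum0 s0] at h
    exact h
  have s1' : ∀ x ∈ F, o.cdHat (x * cs.simple s) ws = g x := by
    refine o.eq_of_kernel_recursion (f := fun x => o.cdHat (x * cs.simple s) ws) (c := c1)
      (fun x hx => ?_) gr
    have h := (recs hx).2.2.1
    rw [sum0 s0] at h
    exact h
  have s2 : ∀ x ∈ F, o.cdHat x ws = o.cdHat x wr := by
    refine o.eq_of_kernel_recursion (f := fun x => o.cdHat x ws)
      (fun x hx => (recs hx).2.2.2) fun x hx => ?_
    rw [(recr hx).2.2.2]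
    congr 2
    refine Finset.sum_congr rfl fun y hy => ?_
    rw [r0 y hy, s0 y hy, r1 y hy, s1 y hy, s1' y hy]
  -- Expand from the bottom elements.
  have R1y {y} (hy : y ∈ F) : evalSub (o.rPoly 1 y) = (a - b) * evalSub (o.kernelPoly 1 y) := by
    rw [o.rPoly_eq_kernelPoly, if_neg (memF.1 hy).2.2.symm, zero_add, map_mul, evalSub_X]
  -- Both expansions from 1 are expressed through `p`, `H` and `S`: the sums of K_{1,y}(a - b)
  -- against the values at the top, middle and bottom positions of the fibres.
  set p := o.cdIndex 1 v with hp
  set H := ∑ y ∈ F, evalSub (o.kernelPoly 1 y) * g y with hH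
  set S := ∑ y ∈ F, evalSub (o.kernelPoly 1 y) * o.cdHat y wr with hS
  have hp' : p = ∑ y ∈ F, evalSub (o.kernelPoly 1 y) * o.cdHat y v := sumv 1
  have K11 := o.kernelPoly_fibre hM hs hr (one_mem _) (goodr (one_mem _)) (one_mem _)
    (goodr (one_mem _))
  have K1y {y} (hy : y ∈ F) := o.kernelPoly_fibre hM hs hr (one_mem _) (goodr (one_mem _))
    (hFr y hy).1 (hFr y hy).2
  have R11 : o.rPoly 1 1 = 1 := by rw [rPoly_one, if_pos rfl]
  simp only [mul_one, one_mul, R11, K1] at K11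
  simp only [mul_one, one_mul] at K1y
  have e_rs : o.cdIndex (cs.simple r * cs.simple s) wr = p := by
    rw [sumr, hp', hcr]
    simp only [K11, K1, map_zero, zero_mul, zero_add]
    refine Finset.sum_congr rfl fun y hy => ?_
    simp [K1y hy, r0 y hy]
  have vs_ne : v * cs.simple s ≠ 1 := fun h => mul_simple_notMem_parabolic hs hv (h ▸ one_mem _)
  have h_rs : o.cdHat (cs.simple r * cs.simple s) wr = b * p := by
    rw [o.cdHat_of_ne, e_rs]
    rw [hwr]
    intro h
    rw [mul_left_inj, left_eq_mul] at h
    exact hv1 h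
  have h_r : o.cdHat (cs.simple r) wr = b * (b * p + ((a - b) * p + H)) := by
    rw [o.cdHat_of_ne, sumr]
    · congr 2
      · simp [hcr, K11, K1, h_rs]
      · rw [hp', hH, Finset.mul_sum, ← Finset.sum_add_distrib]
        refine Finset.sum_congr rfl fun y hy => ?_
        simp only [K1y hy, r0 y hy, R1y hy, hg, map_zero, zero_mul, zero_add, add_zero]
        noncomm_ring
    · rw [hwr, mul_assoc, ne_eq, left_eq_mul]
      exact vs_ne
  have h_s : o.cdHat (cs.simple s) wr = b * (b * p + ((a - b) * p + H)) := by
    rw [o.cdHat_of_ne, sumr]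
    · congr 2
      · simp [hcr, K11, K1, h_rs]
      · rw [hp', hH, Finset.mul_sum, ← Finset.sum_add_distrib]
        refine Finset.sum_congr rfl fun y hy => ?_
        simp only [K1y hy, r0 y hy, R1y hy, r1 y hy, map_zero, zero_mul, zero_add, add_zero]
        noncomm_ring
    · rw [hwr, ne_eq, right_eq_mul]
      exact fun h => simple_mul_notMem_parabolic hr hv (h ▸ one_mem _)
  -- The first bracket comes from r, s and rs, with kernels 1, 1 and q from the identity; the second
  -- from the fibres over `F`.
  have e_r : o.cdIndex 1 wr = (b * (b * p + ((a - b) * p + H)) +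
      b * (b * p + ((a - b) * p + H)) + (a - b) * (b * p)) +
      (S + (a - b) * H + (a - b) * H + (a - b) * ((a - b) * p)) := by
    rw [sumr]
    congr 1
    · simp [hcr, K11, K1, h_rs, h_r, h_s, evalSub_X]
    · rw [hp', hH, hS, Finset.mul_sum, Finset.mul_sum, Finset.mul_sum, ← Finset.sum_add_distrib,
        ← Finset.sum_add_distrib, ← Finset.sum_add_distrib]
      refine Finset.sum_congr rfl fun y hy => ?_
      simp only [K1y hy, r0 y hy, R1y hy, r1 y hy, hg, map_mul, evalSub_X]
      noncomm_ring
  have h_s' : o.cdHat (cs.simple s) ws = b * (H + H + (a - b) * p) := by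
    rw [o.cdHat_of_ne, sums]
    · have : ds (cs.simple s) = 0 := by
        simp [hds, K1, o.kernelPoly_eq_zero (u := cs.simple s) (v := cs.simple s) le_rfl]
      rw [this, zero_add]
      congr 1
      rw [hp', hH, Finset.mul_sum, ← Finset.sum_add_distrib, ← Finset.sum_add_distrib]
      refine Finset.sum_congr rfl fun y hy => ?_
      obtain ⟨-, k1, k2, k3, k4⟩ := o.kernelPoly_one_fibre hM hs (hFs y hy).1 (hFs y hy).2
      simp only [k1, k2, k3, k4, s0 y hy, R1y hy, s1 y hy, s1' y hy, map_zero, zero_mul, zero_add]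
      noncomm_ring
    · rw [hws, mul_assoc, ne_eq, left_eq_mul]
      exact vs_ne
  -- The first term comes from s alone. The additional p comes from the summand K_{1,y} in the
  -- kernel from 1 to sys.
  have e_s : o.cdIndex 1 ws = b * (H + H + (a - b) * p) +
      (S + (a - b) * H + (a - b) * H + (p + (a - b) * ((a - b) * p))) := by
    rw [sums]
    congr 1
    · simp [hds, K1, h_s', o.kernelPoly_one_simple hM s]
    · rw [hp', hH, hS, Finset.mul_sum, Finset.mul_sum, Finset.mul_sum, ← Finset.sum_add_distrib,
        ← Finset.sum_add_distrib, ← Finset.sum_add_distrib, ← Finset.sum_add_distrib]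
      refine Finset.sum_congr rfl fun y hy => ?_
      obtain ⟨⟨k1, k2, k3⟩, -⟩ := o.kernelPoly_one_fibre hM hs (hFs y hy).1 (hFs y hy).2
      simp only [k1, k2, k3, s0 y hy, R1y hy, s1 y hy, s1' y hy, s2 y hy, map_add, map_mul,
        evalSub_X]
      noncomm_ring
  -- The terms in `H` and `S` cancel; for the coefficient of p there remains 2ba + (a - b)b = b(a -
  -- b) + ab + ba.
  rw [e_r, e_s, d]
  noncomm_ring

end ReflectionOrdering

end CoxeterSystem

end

theorem theorem6 {B W : Type*} [Finite B] [Group W] {M : CoxeterMatrix B}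
    (cs : CoxeterSystem M W) (hM : M.IsThreeComplete) (r s : B) (hrs : r ≠ s)
    (v : W) (hv : v ∈ cs.parabolic {i | i ≠ r ∧ i ≠ s}) (hv1 : v ≠ 1)
    (o₁ o₂ o₃ o₄ : cs.ReflectionOrdering) :
    CompleteCD.completeCDIndex o₁ 1 (cs.simple s * v * cs.simple s)
        + CompleteCD.d * CompleteCD.completeCDIndex o₂ 1 v
      = CompleteCD.completeCDIndex o₃ 1 (cs.simple r * v * cs.simple s)
        + CompleteCD.completeCDIndex o₄ 1 v := by
  -- For distinct endpoints there is no empty path, so `completeCDIndex` and `cdIndex` agree.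
  have hne (t : B) (ht : t = r ∨ t = s) : 1 ≠ cs.simple t * v * cs.simple s := by
    intro h
    have h2 : cs.simple t * cs.simple s = v := by
      rw [eq_comm, mul_assoc, mul_eq_one_iff_inv_eq, CoxeterSystem.inv_simple,
        ← mul_inv_eq_iff_eq_mul, CoxeterSystem.inv_simple] at h
      exact h
    rcases ht with rfl | rfl
    -- For t = r, the equality v = rs would put s into the parabolic subgroup that omits it.
    · refine CoxeterSystem.simple_notMem_parabolic (cs := cs) (J := {i | i ≠ s})
        (s := s) (by simp) ?_
      have hv' : v ∈ cs.parabolic {i | i ≠ s} :=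
        Subgroup.closure_mono (Set.image_mono fun i hi => hi.2) hv
      rwa [← h2, Subgroup.mul_mem_cancel_left _ (CoxeterSystem.simple_mem_parabolic hrs)] at hv'
    · exact hv1 (by rw [← h2, CoxeterSystem.simple_mul_simple_self])
  rw [o₁.completeCDIndex_of_ne (hne s (Or.inr rfl)), o₂.completeCDIndex_of_ne hv1.symm,
    o₃.completeCDIndex_of_ne (hne r (Or.inl rfl)), o₄.completeCDIndex_of_ne hv1.symm,
    CoxeterSystem.ReflectionOrdering.cdIndex_eq hM o₂ o₁,
    CoxeterSystem.ReflectionOrdering.cdIndex_eq hM o₃ o₁,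
    CoxeterSystem.ReflectionOrdering.cdIndex_eq hM o₄ o₁]
  exact o₁.cdIndex_conj_add hM hrs hv hv1
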